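/- **Setting.** Consider a two-user finite-state multiple-access channel with finite state set $\mathcal S$, finite input sets $\mathcal X_a,\mathcal X_b$ and finite output set $\mathcal Y$. The states $S_1,S_2,\dots$ are i.i.d. with law $P(s)$ and independent of the messages; the messages $W_a,W_b$ are independent and uniform on finite sets $\mathcal W_a,\mathcal W_b$. Encoder $i\in\{a,b\}$ observes causally only $V^{(i)}_t=q_i(S_t)$, where $q_i:\mathcal S\to\mathcal V_i$ is a fixed quantizer, and sends $X^{(i)}_t=\phi^{(i)}_t(W_i,V^{(i)}_1,\dots,V^{(i)}_t)\in\mathcal X_i$. The channel is memoryless and without feedback: given messages and states, the outputs $Y_1,Y_2,\dots$ are independent and $Y_t$ has law $P(\cdot\mid S_t,X^{(a)}_t,X^{(b)}_t)$. The decoder computes $\hat W=\psi(S_1,\dots,S_n,Y_1,\dots,Y_n)$. A pair $R=(R_a,R_b)$ with $R_a,R_b\ge 0$ is achievable if for every $\varepsilon>0$ there are a block length $n\ge1$ and such encoders and decoder with $|\mathcal W_i|\ge 2^{nR_i}$ for $i\in\{a,b\}$ and $\Pr(\hat W\neq (W_a,W_b))\le\varepsilon$. The capacity region is the closure in $\mathbb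 R^2$ of the set of achievable rate pairs. A memoryless stationary team policy $\pi$ consists of probability distributions $\pi_a(\cdot\mid v_a)$ on $\mathcal X_a$ and $\pi_b(\cdot\mid v_b)$ on $\mathcal X_b$ for all $v_a\in\mathcal V_a$, $v_b\in\mathcal V_b$. Let $\mathcal R(\pi)$ be the set of all $(R_a,R_b)$ with $$0\le R_a<I(X_a;Y\mid X_b,S),\qquad 0\le R_b<I(X_b;Y\mid X_a,S),\qquad 0\le R_a+R_b<I(X_a,X_b;Y\mid S),$$ where the informations are in bits and $(S,X_a,X_b,Y)$ has joint law $P(s)\,\pi_a(x_a\mid q_a(s))\,\pi_b(x_b\mid q_b(s))\,P(y\mid s,x_a,x_b)$. Let $\overline{\mathcal R}(\pi)$ be the set defined by the same inequalities with every $<$ replaced by $\le$. **Theorem 1.** If $\mathcal R(\pi)\neq\emptyset$ for at least one $\pi$, then the capacity region is the closure of the convex hull of $\bigcup_\pi\mathcal R(\pi)$, the union being over all memoryless stationary team policies. In every case, also when all $\mathcal R(\pi)$ are empty, the capacity region is the closure of the convex hull of $\bigcup_\pi\overline{\mathcal R}(\pi)$. -/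

import Mathlib

noncomputable section

/-! ### Entropies of random variables on a finite probability space

A probability space is a finite type `Ω` with a mass function `p : Ω → ℝ`; random variables are
functions on `Ω` with values in finite types. Logarithms are to base 2. -/

namespace FiniteProb

open Classical in
/-- The law of the random variable `f`: `P(f = a)`. -/
def law {Ω A : Type*} [Fintype Ω] (p : Ω → ℝ) (f : Ω → A) (a : A) : ℝ :=
  ∑ ω, if f ω = a then p ω else 0

/-- Shannon entropy `H(f) = - ∑ a, P(f = a) log₂ P(f = a)` (with `0 log₂ 0 = 0`). -/
def entropy {Ω A : Type*} [Fintype Ω] [Fintype A] (p : Ω → ℝ) (f : Ω → A) : ℝ :=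
  - ∑ a, law p f a * Real.logb 2 (law p f a)

/-- Conditional entropy `H(f | h) = H(f, h) - H(h)`. -/
def condEntropy {Ω A C : Type*} [Fintype Ω] [Fintype A] [Fintype C]
    (p : Ω → ℝ) (f : Ω → A) (h : Ω → C) : ℝ :=
  entropy p (fun ω => (f ω, h ω)) - entropy p h

/-- Conditional mutual information `I(f; g | h) = H(f | h) - H(f | g, h)`. -/
def condMutualInfo {Ω A B C : Type*} [Fintype Ω] [Fintype A] [Fintype B] [Fintype C]
    (p : Ω → ℝ) (f : Ω → A) (g : Ω → B) (h : Ω → C) : ℝ :=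
  condEntropy p f h - condEntropy p f (fun ω => (g ω, h ω))

end FiniteProb

/-- A two-user finite-state multiple-access channel with i.i.d. state: the law `P(s)` of the state,
the two quantizers through which the encoders observe the state, and the transition
probabilities `P(y | s, (xa, xb))`. -/
structure FSMAC (S Va Vb Xa Xb Y : Type*) [Fintype S] [Fintype Y] where
  stateLaw : S → ℝ
  stateLaw_mem : stateLaw ∈ stdSimplex ℝ S
  qa : S → Va
  qb : S → Vb
  chan : S → Xa → Xb → Y → ℝ
  chan_mem : ∀ s xa xb, chan s xa xb ∈ stdSimplex ℝ Y

/-- A memoryless stationary team policy: a probability distribution `πa(· | va)` on the inputs of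
encoder `a` for every quantized observation `va`, and the same for encoder `b`. -/
structure TeamPolicy (Va Vb Xa Xb : Type*) [Fintype Xa] [Fintype Xb] where
  πa : Va → Xa → ℝ
  πa_mem : ∀ v, πa v ∈ stdSimplex ℝ Xa
  πb : Vb → Xb → ℝ
  πb_mem : ∀ v, πb v ∈ stdSimplex ℝ Xb

/-- The encoding and decoding functions of a block code of length `n` with `Ma` and `Mb` messages.
Time runs over `Fin n`. At time `t` an encoder uses its message and its quantized observations at
the times `0, …, t`; the decoder uses the whole state and output sequences. -/
structure BlockCode (S Va Vb Xa Xb Y : Type*) (n Ma Mb : ℕ) where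
  encA : (t : Fin n) → Fin Ma → (Fin (t + 1) → Va) → Xa
  encB : (t : Fin n) → Fin Mb → (Fin (t + 1) → Vb) → Xb
  dec : (Fin n → S) → (Fin n → Y) → Fin Ma × Fin Mb

namespace FSMAC

variable {S Va Vb Xa Xb Y : Type*} [Fintype S] [Fintype Xa] [Fintype Xb] [Fintype Y]

/-- The input of encoder `a` at time `t`, for the message `w` and the state sequence `s`. -/
def inputA (C : FSMAC S Va Vb Xa Xb Y) {n Ma Mb : ℕ} (c : BlockCode S Va Vb Xa Xb Y n Ma Mb)
    (w : Fin Ma) (s : Fin n → S) (t : Fin n) : Xa :=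
  c.encA t w (fun j => C.qa (s (Fin.castLE t.isLt j)))

/-- The input of encoder `b` at time `t`, for the message `w` and the state sequence `s`. -/
def inputB (C : FSMAC S Va Vb Xa Xb Y) {n Ma Mb : ℕ} (c : BlockCode S Va Vb Xa Xb Y n Ma Mb)
    (w : Fin Mb) (s : Fin n → S) (t : Fin n) : Xb :=
  c.encB t w (fun j => C.qb (s (Fin.castLE t.isLt j)))

/-- The joint law of messages, states and outputs: the two messages are uniform, the states are
i.i.d. with law `P`, messages and states are independent, and, given messages and states, the
outputs are drawn independently, the one at time `t` from `P(· | s_t, x_t)`. -/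
def jointLaw (C : FSMAC S Va Vb Xa Xb Y) {n Ma Mb : ℕ} (c : BlockCode S Va Vb Xa Xb Y n Ma Mb)
    (w : Fin Ma × Fin Mb) (s : Fin n → S) (y : Fin n → Y) : ℝ :=
  (1 / (Ma : ℝ)) * (1 / (Mb : ℝ)) * (∏ t, C.stateLaw (s t)) *
    ∏ t, C.chan (s t) (C.inputA c w.1 s t) (C.inputB c w.2 s t) (y t)

/-- The probability that the decoded message pair differs from the transmitted one. -/
def errorProb (C : FSMAC S Va Vb Xa Xb Y) {n Ma Mb : ℕ}
    (c : BlockCode S Va Vb Xa Xb Y n Ma Mb) : ℝ :=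
  ∑ w : Fin Ma × Fin Mb, ∑ s : Fin n → S, ∑ y : Fin n → Y,
    if c.dec s y ≠ w then C.jointLaw c w s y else 0

/-- There is an `(R, n, ε)`-coding scheme. -/
def HasCodingScheme (C : FSMAC S Va Vb Xa Xb Y) (R : ℝ × ℝ) (n : ℕ) (ε : ℝ) : Prop :=
  ∃ (Ma Mb : ℕ) (c : BlockCode S Va Vb Xa Xb Y n Ma Mb),
    (2 : ℝ) ^ (R.1 * (n : ℝ)) ≤ (Ma : ℝ) ∧ (2 : ℝ) ^ (R.2 * (n : ℝ)) ≤ (Mb : ℝ) ∧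
      C.errorProb c ≤ ε

/-- A pair of (nonnegative) rates is achievable if for every `ε > 0` there is an
`(R, n, ε)`-coding scheme for some block length `n ≥ 1`. -/
def Achievable (C : FSMAC S Va Vb Xa Xb Y) (R : ℝ × ℝ) : Prop :=
  0 ≤ R.1 ∧ 0 ≤ R.2 ∧ ∀ ε : ℝ, 0 < ε → ∃ n : ℕ, 1 ≤ n ∧ C.HasCodingScheme R n ε

/-- The capacity region: the closure of the set of achievable rate pairs. -/
def capacityRegion (C : FSMAC S Va Vb Xa Xb Y) : Set (ℝ × ℝ) :=
  closure {R | C.Achievable R}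

/-- The joint law `ν(s, xa, xb, y) = P(s) πa(xa | qa s) πb(xb | qb s) P(y | s, (xa, xb))` of state,
inputs and output under a team policy. -/
def policyLaw (C : FSMAC S Va Vb Xa Xb Y) (π : TeamPolicy Va Vb Xa Xb) :
    S × Xa × Xb × Y → ℝ :=
  fun ⟨s, xa, xb, y⟩ => C.stateLaw s * π.πa (C.qa s) xa * π.πb (C.qb s) xb * C.chan s xa xb y

/-- `I(Xa; Y | Xb, S)` under the policy `π`. -/
def infoA (C : FSMAC S Va Vb Xa Xb Y) (π : TeamPolicy Va Vb Xa Xb) : ℝ :=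
  FiniteProb.condMutualInfo (C.policyLaw π)
    (fun ⟨_, xa, _, _⟩ => xa) (fun ⟨_, _, _, y⟩ => y) (fun ⟨s, _, xb, _⟩ => (xb, s))

/-- `I(Xb; Y | Xa, S)` under the policy `π`. -/
def infoB (C : FSMAC S Va Vb Xa Xb Y) (π : TeamPolicy Va Vb Xa Xb) : ℝ :=
  FiniteProb.condMutualInfo (C.policyLaw π)
    (fun ⟨_, _, xb, _⟩ => xb) (fun ⟨_, _, _, y⟩ => y) (fun ⟨s, xa, _, _⟩ => (xa, s))

/-- `I(X; Y | S)` with `X = (Xa, Xb)`, under the policy `π`. -/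
def infoSum (C : FSMAC S Va Vb Xa Xb Y) (π : TeamPolicy Va Vb Xa Xb) : ℝ :=
  FiniteProb.condMutualInfo (C.policyLaw π)
    (fun ⟨_, xa, xb, _⟩ => (xa, xb)) (fun ⟨_, _, _, y⟩ => y) (fun ⟨s, _, _, _⟩ => s)

/-- The rate region `R(π)` of a team policy, given by strict inequalities. It is empty when one of
the informations vanishes. -/
def region (C : FSMAC S Va Vb Xa Xb Y) (π : TeamPolicy Va Vb Xa Xb) : Set (ℝ × ℝ) :=
  {R | (0 ≤ R.1 ∧ R.1 < C.infoA π) ∧ (0 ≤ R.2 ∧ R.2 < C.infoB π) ∧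
    (0 ≤ R.1 + R.2 ∧ R.1 + R.2 < C.infoSum π)}

/-- The rate region of a team policy, given by weak inequalities. -/
def closedRegion (C : FSMAC S Va Vb Xa Xb Y) (π : TeamPolicy Va Vb Xa Xb) : Set (ℝ × ℝ) :=
  {R | (0 ≤ R.1 ∧ R.1 ≤ C.infoA π) ∧ (0 ≤ R.2 ∧ R.2 ≤ C.infoB π) ∧
    (0 ≤ R.1 + R.2 ∧ R.1 + R.2 ≤ C.infoSum π)}

end FSMAC

end

/-!
The capacity region of the channel is the closed convex hull of the pentagons of the team
policies. Everything is computed with mean log-likelihood ratios: for independent inputs with laws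
`p` and `r` and a channel `K`, the functionals `divFirst`, `divSecond` and `divBoth` are the three
mutual informations in nats, and `infoA_mul_log_two`, `infoB_mul_log_two`, `infoSum_mul_log_two`
express the informations of a policy as their averages over the state. Gibbs' inequality
`sum_mul_log_div_le` gives all the inequalities that are needed between them.

*Achievability* (`achievable_of_lt_mixture`). Encoders transmit Shannon strategies, that is, maps
from states to inputs, so that the state at the encoders disappears and the state at the decoder
becomes part of the output (`strategyChannel`). For a finite family of policies with weights, a
time-sharing sequence is drawn i.i.d. from the weights along with the codebooks; it is fixed
together with them in the end. The decoder looks for the only message pair whose likelihood beats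
its three averages by given thresholds. The expected error (`exists_code_of_thresholds`) is the
probability that the true pair fails the test, which Chebyshev's inequality sends to zero, plus a
union bound over wrong pairs. Drawing the time-sharing sequence at random yields the convex hull
directly, without concatenating codes. A rate that is zero needs one message only, and this is how
the closed pentagons are reached even if some information vanishes.

*Converse* (`exists_mixture_of_hasCodingScheme`). Compare the law of messages, states and outputs
with a reference under which the output at time `t` has the law it would have if one of the
messages (or both) were redrawn uniformly, anew at each time. Under the reference the decoder can
only guess that message, so the divergence between the two laws is almost the logarithm of the
number of messages (`fano_of_reference`). On the other hand this divergence is exactly a sum over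
times and state sequences of single-letter informations: for a fixed past, the messages induce a
memoryless team policy (`inducedPolicy`), with independent inputs since the messages are
independent. Hence the rates lie, up to a vanishing correction, in an average of pentagons. Since
the pentagons satisfy `max (I_a, I_b) ≤ I_s ≤ I_a + I_b`, an average of pentagons consists of
averages of their points (`exists_pentagon_decomposition`).

If some strict region is nonempty, the strict regions are dense in the closed ones: a point with
positive rates is scaled down, and in the other cases the policy is mixed with one for which all
informations are positive (`closedRegion_subset_closure`).
-/

/-! ### Product laws on finite powers -/

section ProductLaw

variable {ι α : Type*} [Fintype ι] [DecidableEq ι] [Fintype α]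

/-- Redrawing one coordinate of a random vector with independent coordinates does not change its
law. All marginals of product laws are computed from this identity. -/
theorem sum_pi_resample (p : ι → α → ℝ) (i : ι) (hp : ∑ x, p i x = 1) (F : (ι → α) → ℝ) :
    ∑ f : ι → α, (∏ j, p j (f j)) * F f =
      ∑ f : ι → α, (∏ j, p j (f j)) * ∑ x, p i x * F (Function.update f i x) := by
  classical
  let σ : (ι → α) × α → (ι → α) × α := fun z => (Function.update z.1 i z.2, z.1 i)
  have hσ : Function.Involutive σ := by
    rintro ⟨f, x⟩
    simp [σ]
  have hw : ∀ (f : ι → α) (x : α), (∏ j, p j (Function.update f i x j)) * p i (f i) =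
      (∏ j, p j (f j)) * p i x := by
    intro f x
    rw [← Finset.mul_prod_erase Finset.univ _ (Finset.mem_univ i),
      ← Finset.mul_prod_erase Finset.univ (fun j => p j (f j)) (Finset.mem_univ i)]
    have : ∏ j ∈ Finset.univ.erase i, p j (Function.update f i x j) =
        ∏ j ∈ Finset.univ.erase i, p j (f j) := by
      refine Finset.prod_congr rfl fun j hj => ?_
      rw [Function.update_of_ne (Finset.ne_of_mem_erase hj)]
    rw [this, Function.update_self]
    ring
  calc ∑ f : ι → α, (∏ j, p j (f j)) * F f
      = ∑ z : (ι → α) × α, (∏ j, p j (z.1 j)) * p i z.2 * F z.1 := by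
        rw [Fintype.sum_prod_type]
        refine Finset.sum_congr rfl fun f _ => ?_
        dsimp only
        rw [← Finset.sum_mul, ← Finset.mul_sum, hp, mul_one]
    _ = ∑ z : (ι → α) × α, (∏ j, p j ((σ z).1 j)) * p i (σ z).2 * F (σ z).1 :=
        (Equiv.sum_comp hσ.toPerm
          (fun z : (ι → α) × α => (∏ j, p j (z.1 j)) * p i z.2 * F z.1)).symm
    _ = ∑ f : ι → α, (∏ j, p j (f j)) * ∑ x, p i x * F (Function.update f i x) := by
        rw [Fintype.sum_prod_type]
        refine Finset.sum_congr rfl fun f _ => ?_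
        rw [Finset.mul_sum]
        refine Finset.sum_congr rfl fun x _ => ?_
        simp only [σ]
        rw [hw]
        ring

theorem sum_pi_prod (p : ι → α → ℝ) (hp : ∀ i, ∑ x, p i x = 1) :
    ∑ f : ι → α, ∏ j, p j (f j) = 1 := by
  rw [← Fintype.piFinset_univ, ← Finset.prod_univ_sum]
  simp [hp]

theorem sum_pi_eval (p : ι → α → ℝ) (hp : ∀ i, ∑ x, p i x = 1) (i : ι) (F : α → ℝ) :
    ∑ f : ι → α, (∏ j, p j (f j)) * F (f i) = ∑ x, p i x * F x := by
  rw [sum_pi_resample p i (hp i)]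
  simp only [Function.update_self]
  rw [← Finset.sum_mul, sum_pi_prod p hp, one_mul]

theorem sum_pi_eval_two (p : ι → α → ℝ) (hp : ∀ i, ∑ x, p i x = 1) {i k : ι} (hik : k ≠ i)
    (F : α → α → ℝ) :
    ∑ f : ι → α, (∏ j, p j (f j)) * F (f i) (f k) = ∑ x, ∑ x', p i x * p k x' * F x x' := by
  rw [sum_pi_resample p i (hp i)]
  simp only [Function.update_self, Function.update_of_ne hik]
  rw [sum_pi_eval p hp k (fun x' => ∑ x, p i x * F x x')]
  simp only [Finset.mul_sum]
  rw [Finset.sum_comm]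
  refine Finset.sum_congr rfl fun x _ => Finset.sum_congr rfl fun x' _ => ?_
  ring

/-- The second moment of a sum of i.i.d. centred variables is `n` times that of one variable. -/
theorem sum_pi_sq_sum (p : α → ℝ) (hp : ∑ x, p x = 1) (g : α → ℝ) (hg : ∑ x, p x * g x = 0) :
    ∑ f : ι → α, (∏ j, p (f j)) * (∑ j, g (f j)) ^ 2 =
      Fintype.card ι * ∑ x, p x * g x ^ 2 := by
  have h1 : ∀ f : ι → α, (∏ j, p (f j)) * (∑ j, g (f j)) ^ 2 =
      ∑ i, ∑ k, (∏ j, p (f j)) * (g (f i) * g (f k)) := by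
    intro f
    rw [sq, Finset.sum_mul_sum]
    simp only [Finset.mul_sum]
  simp only [h1]
  rw [Finset.sum_comm]
  have h2 : ∀ i : ι, ∑ f : ι → α, ∑ k, (∏ j, p (f j)) * (g (f i) * g (f k)) =
      ∑ x, p x * g x ^ 2 := by
    intro i
    rw [Finset.sum_comm, Finset.sum_eq_single i]
    · rw [sum_pi_eval (fun _ => p) (fun _ => hp) i (fun x => g x * g x)]
      simp only [sq]
    · intro k _ hk
      rw [sum_pi_eval_two (fun _ => p) (fun _ => hp) hk (fun x x' => g x * g x')]
      have : ∀ x x' : α, p x * p x' * (g x * g x') = p x * g x * (p x' * g x') := by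
        intros; ring
      simp only [this]
      rw [← Finset.sum_mul_sum, hg, zero_mul]
    · simp
  simp [h2]

open Classical in
/-- Chebyshev's inequality for the lower tail of a sum of i.i.d. variables with mean above `γ`. -/
theorem sum_pi_lower_tail (p : α → ℝ) (hp0 : ∀ x, 0 ≤ p x) (hp : ∑ x, p x = 1) (g : α → ℝ)
    {γ : ℝ} (hγ : γ < ∑ x, p x * g x) (n : ℕ) (hn : 1 ≤ n) :
    ∑ f : Fin n → α, (∏ j, p (f j)) * (if ∑ j, g (f j) < n * γ then 1 else 0) ≤
      (∑ x, p x * (g x - ∑ x', p x' * g x') ^ 2) / (∑ x, p x * g x - γ) ^ 2 / n := by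
  set m := ∑ x, p x * g x with hm
  have hn0 : (0 : ℝ) < n := by exact_mod_cast hn
  have hd : 0 < m - γ := sub_pos.2 hγ
  have hc : ∑ x, p x * (g x - m) = 0 := by
    simp only [mul_sub, Finset.sum_sub_distrib, ← Finset.sum_mul, hp, ← hm]
    ring
  have hsq := sum_pi_sq_sum (ι := Fin n) p hp (fun x => g x - m) hc
  rw [Fintype.card_fin] at hsq
  have hle : ∑ f : Fin n → α, (∏ j, p (f j)) * (if ∑ j, g (f j) < n * γ then 1 else 0) ≤
      ∑ f : Fin n → α, (∏ j, p (f j)) * (∑ j, (g (f j) - m)) ^ 2 / (n * (m - γ)) ^ 2 := by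
    refine Finset.sum_le_sum fun f _ => ?_
    rw [mul_div_assoc]
    refine mul_le_mul_of_nonneg_left ?_ (Finset.prod_nonneg fun j _ => hp0 _)
    split_ifs with h
    · rw [le_div_iff₀ (by positivity), one_mul]
      have : ∑ j, (g (f j) - m) = ∑ j, g (f j) - n * m := by simp
      rw [this]
      rw [sq_le_sq, abs_of_pos (by positivity), abs_of_neg (by nlinarith)]
      linarith
    · positivity
  refine hle.trans (le_of_eq ?_)
  rw [← Finset.sum_div, hsq]
  field_simp

theorem sum_pi_prod_type {β : Type*} [Fintype β] (F : (ι → α × β) → ℝ) :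
    ∑ f : ι → α × β, F f = ∑ a : ι → α, ∑ b : ι → β, F (fun i => (a i, b i)) := by
  rw [← Fintype.sum_prod_type' (f := fun (a : ι → α) (b : ι → β) => F (fun i => (a i, b i)))]
  exact (Equiv.sum_comp (Equiv.arrowProdEquivProdArrow ι (fun _ => α) (fun _ => β)).symm F).symm

end ProductLaw

/-! ### Gibbs' inequality -/

/-- Gibbs' inequality, for arbitrary masses: the relative entropy of `p` with respect to `q` is at
least the difference of the total masses. -/
theorem sum_mul_log_div_le {ι : Type*} [Fintype ι] (p q : ι → ℝ) (hp : ∀ i, 0 ≤ p i)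
    (hq : ∀ i, 0 ≤ q i) (hpq : ∀ i, q i = 0 → p i = 0) :
    ∑ i, p i * Real.log (q i / p i) ≤ ∑ i, q i - ∑ i, p i := by
  rw [← Finset.sum_sub_distrib]
  refine Finset.sum_le_sum fun i _ => ?_
  rcases (hp i).eq_or_lt with h | h
  · simp [← h, hq i]
  · have hqi : 0 < q i := (hq i).lt_of_ne fun h0 => h.ne' (hpq i h0.symm)
    have := Real.log_le_sub_one_of_pos (div_pos hqi h)
    calc p i * Real.log (q i / p i) ≤ p i * (q i / p i - 1) :=
          mul_le_mul_of_nonneg_left this h.le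
      _ = q i - p i := by field_simp

/-! ### Divergence functionals of a two-user channel -/

section Divergence

variable {A B Y : Type*} [Fintype A]

/-- The output law of the channel `K` given the input `b` of the second user, when the first input
has law `p`. -/
def outGiven (p : A → ℝ) (K : A → B → Y → ℝ) (b : B) (y : Y) : ℝ :=
  ∑ a, p a * K a b y

theorem outGiven_mem [Fintype Y] {p : A → ℝ} {K : A → B → Y → ℝ}
    (hp : p ∈ stdSimplex ℝ A) (hK : ∀ a b, K a b ∈ stdSimplex ℝ Y) (b : B) :
    outGiven p K b ∈ stdSimplex ℝ Y := by
  refine ⟨fun y => Finset.sum_nonneg fun a _ => mul_nonneg (hp.1 a) ((hK a b).1 y), ?_⟩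
  unfold outGiven
  rw [Finset.sum_comm]
  simp only [← Finset.mul_sum, (hK _ _).2, mul_one, hp.2]

theorem outGiven_ne_zero [Fintype Y] {p : A → ℝ} {K : A → B → Y → ℝ}
    (hp : ∀ a, 0 ≤ p a) (hK : ∀ a b, K a b ∈ stdSimplex ℝ Y) {a : A} {b : B} {y : Y}
    (ha : p a ≠ 0) (h : K a b y ≠ 0) : outGiven p K b y ≠ 0 := by
  intro h0
  have := (Finset.sum_eq_zero_iff_of_nonneg
    fun a _ => mul_nonneg (hp a) ((hK a b).1 y)).1 h0 a (Finset.mem_univ a)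
  exact mul_ne_zero ha h this

variable [Fintype B]

/-- The output law of the channel `K` under independent inputs with laws `p` and `r`. -/
def outBoth (p : A → ℝ) (r : B → ℝ) (K : A → B → Y → ℝ) (y : Y) : ℝ :=
  ∑ a, ∑ b, p a * r b * K a b y

theorem outBoth_eq_sum_outGiven (p : A → ℝ) (r : B → ℝ) (K : A → B → Y → ℝ) (y : Y) :
    outBoth p r K y = ∑ b, r b * outGiven p K b y := by
  unfold outBoth outGiven
  rw [Finset.sum_comm]
  simp only [Finset.mul_sum]
  refine Finset.sum_congr rfl fun b _ => Finset.sum_congr rfl fun a _ => ?_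
  ring

theorem outBoth_swap (p : A → ℝ) (r : B → ℝ) (K : A → B → Y → ℝ) :
    outBoth r p (fun b a => K a b) = outBoth p r K := by
  funext y
  unfold outBoth
  rw [Finset.sum_comm]
  simp only [mul_comm (r _)]

variable [Fintype Y]

/-- The mean log-likelihood ratio, in nats, of the channel `K` against the reference law `q`, which
may depend on the inputs. -/
noncomputable def meanLogRatio (p : A → ℝ) (r : B → ℝ) (K q : A → B → Y → ℝ) : ℝ :=
  ∑ a, ∑ b, ∑ y, p a * r b * K a b y * Real.log (K a b y / q a b y)

/-- `I(A; Y | B)` in nats, for independent inputs with laws `p` and `r`. -/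
noncomputable def divFirst (p : A → ℝ) (r : B → ℝ) (K : A → B → Y → ℝ) : ℝ :=
  meanLogRatio p r K fun _ b y => outGiven p K b y

/-- `I(B; Y | A)` in nats, for independent inputs with laws `p` and `r`. -/
noncomputable def divSecond (p : A → ℝ) (r : B → ℝ) (K : A → B → Y → ℝ) : ℝ :=
  meanLogRatio p r K fun a _ y => outGiven r (fun b a => K a b) a y

/-- `I(A, B; Y)` in nats, for independent inputs with laws `p` and `r`. -/
noncomputable def divBoth (p : A → ℝ) (r : B → ℝ) (K : A → B → Y → ℝ) : ℝ :=
  meanLogRatio p r K fun _ _ y => outBoth p r K y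

theorem meanLogRatio_swap (p : A → ℝ) (r : B → ℝ) (K q : A → B → Y → ℝ) :
    meanLogRatio r p (fun b a => K a b) (fun b a => q a b) = meanLogRatio p r K q := by
  unfold meanLogRatio
  rw [Finset.sum_comm]
  simp only [mul_comm (r _)]

theorem divFirst_swap (p : A → ℝ) (r : B → ℝ) (K : A → B → Y → ℝ) :
    divFirst r p (fun b a => K a b) = divSecond p r K :=
  meanLogRatio_swap p r K fun a _ y => outGiven r (fun b a => K a b) a y

theorem divBoth_swap (p : A → ℝ) (r : B → ℝ) (K : A → B → Y → ℝ) :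
    divBoth r p (fun b a => K a b) = divBoth p r K := by
  unfold divBoth
  rw [outBoth_swap]
  exact meanLogRatio_swap p r K fun _ _ y => outBoth p r K y

variable {p : A → ℝ} {r : B → ℝ} {K : A → B → Y → ℝ}

theorem outBoth_mem (hp : p ∈ stdSimplex ℝ A) (hr : r ∈ stdSimplex ℝ B)
    (hK : ∀ a b, K a b ∈ stdSimplex ℝ Y) : outBoth p r K ∈ stdSimplex ℝ Y := by
  have h : outBoth p r K = fun y => ∑ b, r b * outGiven p K b y := by
    funext y
    exact outBoth_eq_sum_outGiven p r K y
  rw [h]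
  refine ⟨fun y => Finset.sum_nonneg fun b _ =>
    mul_nonneg (hr.1 b) ((outGiven_mem hp hK b).1 y), ?_⟩
  rw [Finset.sum_comm]
  simp only [← Finset.mul_sum, (outGiven_mem hp hK _).2, mul_one, hr.2]

theorem outBoth_ne_zero (hp : p ∈ stdSimplex ℝ A) (hr : ∀ b, 0 ≤ r b)
    (hK : ∀ a b, K a b ∈ stdSimplex ℝ Y) {a : A} {b : B} {y : Y} (ha : p a ≠ 0) (hb : r b ≠ 0)
    (h : K a b y ≠ 0) : outBoth p r K y ≠ 0 := by
  rw [outBoth_eq_sum_outGiven]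
  intro h0
  have := (Finset.sum_eq_zero_iff_of_nonneg
    fun b _ => mul_nonneg (hr b) ((outGiven_mem hp hK b).1 y)).1 h0 b (Finset.mem_univ b)
  exact mul_ne_zero hb (outGiven_ne_zero hp.1 hK ha h) this

theorem sum_inputs_mul_channel (hp : p ∈ stdSimplex ℝ A) (hr : r ∈ stdSimplex ℝ B)
    (hK : ∀ a b, K a b ∈ stdSimplex ℝ Y) : ∑ a, ∑ b, ∑ y, p a * r b * K a b y = 1 := by
  simp only [← Finset.mul_sum, (hK _ _).2, mul_one, hr.2, hp.2]

/-- Gibbs' inequality for two references: if tilting the joint law by `q' / q` gives total mass at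
most one, then replacing the reference `q` by `q'` does not decrease the mean log-ratio. -/
theorem meanLogRatio_le_meanLogRatio (hp : p ∈ stdSimplex ℝ A) (hr : r ∈ stdSimplex ℝ B)
    (hK : ∀ a b, K a b ∈ stdSimplex ℝ Y) {q q' : A → B → Y → ℝ} (hq : ∀ a b y, 0 ≤ q a b y)
    (hq' : ∀ a b y, 0 ≤ q' a b y)
    (hs : ∀ a b y, p a ≠ 0 → r b ≠ 0 → K a b y ≠ 0 → q a b y ≠ 0 ∧ q' a b y ≠ 0)
    (h1 : ∑ a, ∑ b, ∑ y, p a * r b * K a b y * (q' a b y / q a b y) ≤ 1) :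
    meanLogRatio p r K q ≤ meanLogRatio p r K q' := by
  have hJ : ∀ a b y, 0 ≤ p a * r b * K a b y := fun a b y =>
    mul_nonneg (mul_nonneg (hp.1 a) (hr.1 b)) ((hK a b).1 y)
  have hsJ : ∀ a b y, p a * r b * K a b y ≠ 0 → q a b y ≠ 0 ∧ q' a b y ≠ 0 := fun a b y h =>
    hs a b y (left_ne_zero_of_mul (left_ne_zero_of_mul h))
      (right_ne_zero_of_mul (left_ne_zero_of_mul h)) (right_ne_zero_of_mul h)
  have key := sum_mul_log_div_le
    (fun z : A × B × Y => p z.1 * r z.2.1 * K z.1 z.2.1 z.2.2)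
    (fun z : A × B × Y => p z.1 * r z.2.1 * K z.1 z.2.1 z.2.2 *
      (q' z.1 z.2.1 z.2.2 / q z.1 z.2.1 z.2.2))
    (fun z => hJ _ _ _)
    (fun z => mul_nonneg (hJ _ _ _) (div_nonneg (hq' _ _ _) (hq _ _ _)))
    (fun z hz => by
      by_contra hne
      obtain ⟨ha, hb⟩ := hsJ _ _ _ hne
      exact mul_ne_zero hne (div_ne_zero hb ha) hz)
  simp only [Fintype.sum_prod_type] at key
  rw [sum_inputs_mul_channel hp hr hK] at key
  have hsub : meanLogRatio p r K q - meanLogRatio p r K q' =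
      ∑ a, ∑ b, ∑ y, p a * r b * K a b y * Real.log (p a * r b * K a b y *
        (q' a b y / q a b y) / (p a * r b * K a b y)) := by
    unfold meanLogRatio
    simp only [← Finset.sum_sub_distrib]
    refine Finset.sum_congr rfl fun a _ => Finset.sum_congr rfl fun b _ =>
      Finset.sum_congr rfl fun y _ => ?_
    by_cases h : p a * r b * K a b y = 0
    · simp [h]
    · obtain ⟨ha, hb⟩ := hsJ _ _ _ h
      rw [mul_div_cancel_left₀ _ h, Real.log_div (right_ne_zero_of_mul h) ha,
        Real.log_div (right_ne_zero_of_mul h) hb, Real.log_div hb ha]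
      ring
  linarith

/-- Among all references that depend only on the second input, the true conditional output law
minimizes the mean log-ratio. -/
theorem divFirst_le_meanLogRatio (hp : p ∈ stdSimplex ℝ A) (hr : r ∈ stdSimplex ℝ B)
    (hK : ∀ a b, K a b ∈ stdSimplex ℝ Y) {q : B → Y → ℝ} (hq : ∀ b, q b ∈ stdSimplex ℝ Y)
    (hs : ∀ a b y, p a ≠ 0 → r b ≠ 0 → K a b y ≠ 0 → q b y ≠ 0) :
    divFirst p r K ≤ meanLogRatio p r K fun _ b y => q b y := by
  refine meanLogRatio_le_meanLogRatio hp hr hK (fun a b y => (outGiven_mem hp hK b).1 y)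
    (fun a b y => (hq b).1 y)
    (fun a b y ha hb h => ⟨outGiven_ne_zero hp.1 hK ha h, hs a b y ha hb h⟩) ?_
  rw [Finset.sum_comm]
  calc ∑ b, ∑ a, ∑ y, p a * r b * K a b y * (q b y / outGiven p K b y)
      = ∑ b, r b * ∑ y, outGiven p K b y * (q b y / outGiven p K b y) := by
        refine Finset.sum_congr rfl fun b _ => ?_
        rw [Finset.sum_comm, Finset.mul_sum]
        refine Finset.sum_congr rfl fun y _ => ?_
        rw [← Finset.sum_mul]
        have : ∑ a, p a * r b * K a b y = r b * outGiven p K b y := by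
          unfold outGiven
          rw [Finset.mul_sum]
          exact Finset.sum_congr rfl fun a _ => by ring
        rw [this]
        ring
    _ ≤ ∑ b, r b * ∑ y, q b y := by
        refine Finset.sum_le_sum fun b _ => mul_le_mul_of_nonneg_left ?_ (hr.1 b)
        refine Finset.sum_le_sum fun y _ => ?_
        by_cases h : outGiven p K b y = 0
        · rw [h, zero_mul]
          exact (hq b).1 y
        · rw [mul_div_cancel₀ _ h]
    _ = 1 := by simp [(hq _).2, hr.2]

theorem divFirst_le_divBoth (hp : p ∈ stdSimplex ℝ A) (hr : r ∈ stdSimplex ℝ B)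
    (hK : ∀ a b, K a b ∈ stdSimplex ℝ Y) : divFirst p r K ≤ divBoth p r K :=
  divFirst_le_meanLogRatio hp hr hK (q := fun _ => outBoth p r K)
    (fun _ => outBoth_mem hp hr hK)
    (fun _ _ _ ha hb h => outBoth_ne_zero hp hr.1 hK ha hb h)

theorem divSecond_le_divBoth (hp : p ∈ stdSimplex ℝ A) (hr : r ∈ stdSimplex ℝ B)
    (hK : ∀ a b, K a b ∈ stdSimplex ℝ Y) : divSecond p r K ≤ divBoth p r K := by
  rw [← divFirst_swap, ← divBoth_swap]
  exact divFirst_le_divBoth hr hp fun b a => hK a b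

/-- `I(A, B; Y) ≤ I(A; Y | B) + I(B; Y | A)` for independent inputs. -/
theorem divBoth_le_add (hp : p ∈ stdSimplex ℝ A) (hr : r ∈ stdSimplex ℝ B)
    (hK : ∀ a b, K a b ∈ stdSimplex ℝ Y) :
    divBoth p r K ≤ divFirst p r K + divSecond p r K := by
  have hK' : ∀ b a, (fun b a => K a b) b a ∈ stdSimplex ℝ Y := fun b a => hK a b
  set U : B → Y → ℝ := fun b y => outGiven p K b y with hU
  set V : A → Y → ℝ := fun a y => outGiven r (fun b a => K a b) a y with hV
  set T : Y → ℝ := outBoth p r K with hT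
  have hU0 : ∀ b y, 0 ≤ U b y := fun b y => (outGiven_mem hp hK b).1 y
  have hV0 : ∀ a y, 0 ≤ V a y := fun a y => (outGiven_mem hr hK' a).1 y
  have hT0 : ∀ y, 0 ≤ T y := (outBoth_mem hp hr hK).1
  -- Since `log (K / U) + log (K / V) - log (K / T) = log (K / (U V / T))`, the claim compares the
  -- references `K` and `U V / T`.
  have hUr : ∀ y, ∑ b, r b * U b y = T y := fun y => (outBoth_eq_sum_outGiven p r K y).symm
  have hVp : ∀ y, ∑ a, p a * V a y = T y := fun y => by
    rw [hT, ← outBoth_swap]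
    exact (outBoth_eq_sum_outGiven r p (fun b a => K a b) y).symm
  have hne : ∀ a b y, p a ≠ 0 → r b ≠ 0 → K a b y ≠ 0 → U b y ≠ 0 ∧ V a y ≠ 0 ∧ T y ≠ 0 :=
    fun a b y ha hb h => ⟨outGiven_ne_zero hp.1 hK ha h,
      outGiven_ne_zero (K := fun b a => K a b) hr.1 hK' hb h,
      outBoth_ne_zero hp hr.1 hK ha hb h⟩
  have key := meanLogRatio_le_meanLogRatio hp hr hK (q := K)
    (q' := fun a b y => U b y * V a y / T y) (fun a b y => (hK a b).1 y)
    (fun a b y => div_nonneg (mul_nonneg (hU0 b y) (hV0 a y)) (hT0 y))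
    (fun a b y ha hb h => by
      obtain ⟨h1, h2, h3⟩ := hne a b y ha hb h
      exact ⟨h, div_ne_zero (mul_ne_zero h1 h2) h3⟩) ?_
  · have h0 : meanLogRatio p r K K = 0 := by
      unfold meanLogRatio
      refine Finset.sum_eq_zero fun a _ => Finset.sum_eq_zero fun b _ =>
        Finset.sum_eq_zero fun y _ => ?_
      by_cases h : K a b y = 0 <;> simp [h]
    rw [h0] at key
    have : divFirst p r K + divSecond p r K - divBoth p r K =
        meanLogRatio p r K fun a b y => U b y * V a y / T y := by
      unfold divFirst divSecond divBoth meanLogRatio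
      simp only [← Finset.sum_sub_distrib, ← Finset.sum_add_distrib]
      refine Finset.sum_congr rfl fun a _ => Finset.sum_congr rfl fun b _ =>
        Finset.sum_congr rfl fun y _ => ?_
      by_cases h : p a * r b * K a b y = 0
      · simp [h]
      · have hk := right_ne_zero_of_mul h
        obtain ⟨h1, h2, h3⟩ := hne a b y (left_ne_zero_of_mul (left_ne_zero_of_mul h))
          (right_ne_zero_of_mul (left_ne_zero_of_mul h)) hk
        change _ * Real.log (_ / U b y) + _ * Real.log (_ / V a y) - _ * Real.log (_ / T y) = _
        rw [Real.log_div hk h1, Real.log_div hk h2, Real.log_div hk h3,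
          Real.log_div hk (div_ne_zero (mul_ne_zero h1 h2) h3),
          Real.log_div (mul_ne_zero h1 h2) h3, Real.log_mul h1 h2]
        ring
    linarith
  · calc ∑ a, ∑ b, ∑ y, p a * r b * K a b y * (U b y * V a y / T y / K a b y)
        ≤ ∑ a, ∑ b, ∑ y, p a * r b * (U b y * V a y / T y) := by
          refine Finset.sum_le_sum fun a _ => Finset.sum_le_sum fun b _ =>
            Finset.sum_le_sum fun y _ => ?_
          have hpr := mul_nonneg (hp.1 a) (hr.1 b)
          have hq := div_nonneg (mul_nonneg (hU0 b y) (hV0 a y)) (hT0 y)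
          by_cases h : K a b y = 0
          · rw [h]
            simpa using mul_nonneg hpr hq
          · rw [mul_assoc, mul_div_cancel₀ _ h]
      _ = ∑ y, (∑ b, r b * U b y) * (∑ a, p a * V a y) / T y := by
          simp only [Finset.sum_mul_sum, Finset.sum_div]
          rw [Finset.sum_comm]
          rw [Finset.sum_comm (s := (Finset.univ : Finset Y))]
          refine Finset.sum_congr rfl fun b _ => ?_
          rw [Finset.sum_comm]
          refine Finset.sum_congr rfl fun y _ => Finset.sum_congr rfl fun a _ => ?_
          ring
      _ ≤ ∑ y, T y := by
          refine Finset.sum_le_sum fun y _ => ?_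
          rw [hUr, hVp]
          by_cases h : T y = 0
          · simp [h]
          · rw [mul_div_cancel_right₀ _ h]
      _ = 1 := (outBoth_mem hp hr hK).2

/-- `I(A; Y | B)` is linear in the law of `B` and concave in that of `A`, so enlarging both laws at
most up to a factor keeps a proportional share of it. -/
theorem mul_divFirst_le_of_le {p' : A → ℝ} {r' : B → ℝ} (hp : p ∈ stdSimplex ℝ A)
    (hr : r ∈ stdSimplex ℝ B) (hp' : p' ∈ stdSimplex ℝ A)
    (hK : ∀ a b, K a b ∈ stdSimplex ℝ Y) {δ : ℝ} (hδ : 0 < δ) (hpp : ∀ a, δ * p a ≤ p' a)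
    (hrr : ∀ b, δ * r b ≤ r' b) : δ * δ * divFirst p r K ≤ divFirst p' r' K := by
  have hsupp : ∀ a, p a ≠ 0 → p' a ≠ 0 := fun a ha h0 => by
    have := hpp a
    rw [h0] at this
    exact absurd this (not_le.2 (mul_pos hδ ((hp.1 a).lt_of_ne' ha)))
  have h1 : divFirst p r K ≤ meanLogRatio p r K fun _ b y => outGiven p' K b y :=
    divFirst_le_meanLogRatio hp hr hK (outGiven_mem hp' hK)
      fun a b y ha _ h => outGiven_ne_zero hp'.1 hK (hsupp a ha) h
  refine (mul_le_mul_of_nonneg_left h1 (by positivity)).trans ?_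
  unfold divFirst meanLogRatio
  simp only [Finset.mul_sum]
  refine Finset.sum_le_sum fun a _ => Finset.sum_le_sum fun b _ => ?_
  have hl : ∀ c d : ℝ, ∑ y, c * d * K a b y * Real.log (K a b y / outGiven p' K b y) =
      c * d * ∑ y, K a b y * Real.log (K a b y / outGiven p' K b y) := fun c d => by
    rw [Finset.mul_sum]
    exact Finset.sum_congr rfl fun y _ => by ring
  rw [hl, ← Finset.mul_sum, hl]
  by_cases ha : p' a = 0
  · have : p a = 0 := by
      by_contra h
      exact hsupp a h ha
    simp [this, ha]
  · have hD : 0 ≤ ∑ y, K a b y * Real.log (K a b y / outGiven p' K b y) := by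
      have := sum_mul_log_div_le (K a b) (outGiven p' K b) (hK a b).1 (outGiven_mem hp' hK b).1
        (fun y hy => by
          by_contra h
          exact outGiven_ne_zero hp'.1 hK ha h hy)
      rw [(hK a b).2, (outGiven_mem hp' hK b).2, sub_self] at this
      have hneg : ∑ y, K a b y * Real.log (K a b y / outGiven p' K b y) =
          -∑ y, K a b y * Real.log (outGiven p' K b y / K a b y) := by
        rw [← Finset.sum_neg_distrib]
        refine Finset.sum_congr rfl fun y _ => ?_
        rw [← inv_div, Real.log_inv]
        ring
      linarith
    rw [← mul_assoc]
    refine mul_le_mul_of_nonneg_right ?_ hD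
    calc δ * δ * (p a * r b) = (δ * p a) * (δ * r b) := by ring
      _ ≤ p' a * r' b := mul_le_mul (hpp a) (hrr b) (mul_nonneg hδ.le (hr.1 b)) (hp'.1 a)

theorem mul_divSecond_le_of_le {p' : A → ℝ} {r' : B → ℝ} (hp : p ∈ stdSimplex ℝ A)
    (hr : r ∈ stdSimplex ℝ B) (hr' : r' ∈ stdSimplex ℝ B)
    (hK : ∀ a b, K a b ∈ stdSimplex ℝ Y) {δ : ℝ} (hδ : 0 < δ) (hpp : ∀ a, δ * p a ≤ p' a)
    (hrr : ∀ b, δ * r b ≤ r' b) : δ * δ * divSecond p r K ≤ divSecond p' r' K := by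
  rw [← divFirst_swap, ← divFirst_swap]
  exact mul_divFirst_le_of_le hr hp hr' (fun b a => hK a b) hδ hrr hpp

theorem divFirst_nonneg (hp : p ∈ stdSimplex ℝ A) (hr : r ∈ stdSimplex ℝ B)
    (hK : ∀ a b, K a b ∈ stdSimplex ℝ Y) : 0 ≤ divFirst p r K := by
  have h := mul_divFirst_le_of_le hp hr hp (r' := r) hK (δ := 1 / 2) (by norm_num)
    (fun a => by linarith [hp.1 a]) (fun b => by linarith [hr.1 b])
  linarith

theorem divSecond_nonneg (hp : p ∈ stdSimplex ℝ A) (hr : r ∈ stdSimplex ℝ B)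
    (hK : ∀ a b, K a b ∈ stdSimplex ℝ Y) : 0 ≤ divSecond p r K := by
  rw [← divFirst_swap]
  exact divFirst_nonneg hr hp fun b a => hK a b

end Divergence

/-! ### Informations of a team policy as mean divergences -/

namespace FiniteProb

variable {Ω A B C : Type*} [Fintype Ω] [Fintype A] [Fintype B] [Fintype C]

theorem entropy_eq_sum (p : Ω → ℝ) (f : Ω → A) :
    entropy p f = -∑ ω, p ω * Real.logb 2 (law p f (f ω)) := by
  classical
  unfold entropy
  congr 1
  have : ∀ a, law p f a * Real.logb 2 (law p f a) =
      ∑ ω, if f ω = a then p ω * Real.logb 2 (law p f a) else 0 := fun a => by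
    conv_lhs => rw [law, Finset.sum_mul]
    refine Finset.sum_congr rfl fun ω _ => ?_
    by_cases h : f ω = a <;> simp [h, law]
  simp only [this]
  rw [Finset.sum_comm]
  simp

theorem condMutualInfo_mul_log_two (p : Ω → ℝ) (f : Ω → A) (g : Ω → B) (h : Ω → C) :
    condMutualInfo p f g h * Real.log 2 =
      ∑ ω, p ω * (Real.log (law p (fun ω => (f ω, g ω, h ω)) (f ω, g ω, h ω)) +
        Real.log (law p h (h ω)) - Real.log (law p (fun ω => (f ω, h ω)) (f ω, h ω)) -
        Real.log (law p (fun ω => (g ω, h ω)) (g ω, h ω))) := by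
  have h2 : Real.log 2 ≠ 0 := (Real.log_pos one_lt_two).ne'
  unfold condMutualInfo condEntropy
  rw [entropy_eq_sum, entropy_eq_sum, entropy_eq_sum, entropy_eq_sum]
  simp only [mul_sub, mul_add, Finset.sum_sub_distrib, Finset.sum_add_distrib, Real.logb,
    ← mul_div_assoc, ← Finset.sum_div]
  field_simp
  ring

end FiniteProb

theorem ite_mk_eq_mk {α β : Type*} (a c : α) (b d : β) (x : ℝ) [Decidable ((a, b) = (c, d))]
    [Decidable (a = c)] [Decidable (b = d)] :
    (if (a, b) = (c, d) then x else 0) = if a = c then if b = d then x else 0 else 0 := by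
  by_cases h1 : a = c <;> by_cases h2 : b = d <;> simp [h1, h2]

namespace FSMAC

variable {S Va Vb Xa Xb Y : Type*} [Fintype S] [Fintype Xa] [Fintype Xb] [Fintype Y]
  (C : FSMAC S Va Vb Xa Xb Y) (π : TeamPolicy Va Vb Xa Xb)

theorem policyLaw_factors_ne_zero {s : S} {xa : Xa} {xb : Xb} {y : Y}
    (h : C.stateLaw s * π.πa (C.qa s) xa * π.πb (C.qb s) xb * C.chan s xa xb y ≠ 0) :
    C.stateLaw s ≠ 0 ∧ π.πa (C.qa s) xa ≠ 0 ∧ π.πb (C.qb s) xb ≠ 0 ∧ C.chan s xa xb y ≠ 0 :=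
  ⟨left_ne_zero_of_mul (left_ne_zero_of_mul (left_ne_zero_of_mul h)),
    right_ne_zero_of_mul (left_ne_zero_of_mul (left_ne_zero_of_mul h)),
    right_ne_zero_of_mul (left_ne_zero_of_mul h), right_ne_zero_of_mul h⟩

theorem infoA_mul_log_two : C.infoA π * Real.log 2 =
    ∑ s, C.stateLaw s * divFirst (π.πa (C.qa s)) (π.πb (C.qb s)) (C.chan s) := by
  classical
  change FiniteProb.condMutualInfo (C.policyLaw π) (fun ω => ω.2.1) (fun ω => ω.2.2.2)
    (fun ω => (ω.2.2.1, ω.1)) * Real.log 2 = _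
  rw [FiniteProb.condMutualInfo_mul_log_two]
  simp only [Fintype.sum_prod_type, divFirst, meanLogRatio, Finset.mul_sum]
  refine Finset.sum_congr rfl fun s _ => Finset.sum_congr rfl fun xa _ =>
    Finset.sum_congr rfl fun xb _ => Finset.sum_congr rfl fun y _ => ?_
  have e1 : FiniteProb.law (C.policyLaw π) (fun ω => (ω.2.1, ω.2.2.2, ω.2.2.1, ω.1))
      (xa, y, xb, s) = C.policyLaw π (s, xa, xb, y) := by
    simp only [FiniteProb.law, Fintype.sum_prod_type]
    simp only [ite_mk_eq_mk]
    simp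
  have e2 : FiniteProb.law (C.policyLaw π) (fun ω => (ω.2.2.1, ω.1)) (xb, s) =
      C.stateLaw s * π.πb (C.qb s) xb := by
    simp only [FiniteProb.law, Fintype.sum_prod_type]
    simp only [ite_mk_eq_mk]
    simp only [Finset.sum_ite_irrel, Finset.sum_const_zero, Finset.sum_ite_eq',
      Finset.mem_univ, if_true, policyLaw, ← Finset.mul_sum, (C.chan_mem _ _ _).2, mul_one,
      ← Finset.sum_mul, (π.πa_mem _).2]
  have e3 : FiniteProb.law (C.policyLaw π) (fun ω => (ω.2.1, ω.2.2.1, ω.1)) (xa, xb, s) =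
      C.stateLaw s * π.πa (C.qa s) xa * π.πb (C.qb s) xb := by
    simp only [FiniteProb.law, Fintype.sum_prod_type]
    simp only [ite_mk_eq_mk]
    simp only [Finset.sum_ite_irrel, Finset.sum_const_zero, Finset.sum_ite_eq',
      Finset.mem_univ, if_true, policyLaw, ← Finset.mul_sum, (C.chan_mem _ _ _).2, mul_one]
  have e4 : FiniteProb.law (C.policyLaw π) (fun ω => (ω.2.2.2, ω.2.2.1, ω.1)) (y, xb, s) =
      C.stateLaw s * π.πb (C.qb s) xb * outGiven (π.πa (C.qa s)) (C.chan s) xb y := by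
    simp only [FiniteProb.law, Fintype.sum_prod_type]
    simp only [ite_mk_eq_mk]
    simp only [Finset.sum_ite_irrel, Finset.sum_const_zero, Finset.sum_ite_eq',
      Finset.mem_univ, if_true, policyLaw, outGiven, Finset.mul_sum]
    exact Finset.sum_congr rfl fun a _ => by ring
  rw [e1, e2, e3, e4]
  simp only [policyLaw]
  by_cases h : C.stateLaw s * π.πa (C.qa s) xa * π.πb (C.qb s) xb * C.chan s xa xb y = 0
  · rw [h, zero_mul, ← mul_assoc, ← mul_assoc, ← mul_assoc, h, zero_mul]
  · obtain ⟨h1, h2, h3, h4⟩ := C.policyLaw_factors_ne_zero π h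
    have h5 := outGiven_ne_zero (π.πa_mem (C.qa s)).1 (C.chan_mem s) h2 h4
    rw [Real.log_mul (by positivity) h4, Real.log_mul (by positivity) h5, Real.log_div h4 h5]
    ring

theorem infoB_mul_log_two : C.infoB π * Real.log 2 =
    ∑ s, C.stateLaw s * divSecond (π.πa (C.qa s)) (π.πb (C.qb s)) (C.chan s) := by
  classical
  change FiniteProb.condMutualInfo (C.policyLaw π) (fun ω => ω.2.2.1) (fun ω => ω.2.2.2)
    (fun ω => (ω.2.1, ω.1)) * Real.log 2 = _
  rw [FiniteProb.condMutualInfo_mul_log_two]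
  simp only [Fintype.sum_prod_type, divSecond, meanLogRatio, Finset.mul_sum]
  refine Finset.sum_congr rfl fun s _ => Finset.sum_congr rfl fun xa _ =>
    Finset.sum_congr rfl fun xb _ => Finset.sum_congr rfl fun y _ => ?_
  have e1 : FiniteProb.law (C.policyLaw π) (fun ω => (ω.2.2.1, ω.2.2.2, ω.2.1, ω.1))
      (xb, y, xa, s) = C.policyLaw π (s, xa, xb, y) := by
    simp only [FiniteProb.law, Fintype.sum_prod_type]
    simp only [ite_mk_eq_mk]
    simp
  have e2 : FiniteProb.law (C.policyLaw π) (fun ω => (ω.2.1, ω.1)) (xa, s) =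
      C.stateLaw s * π.πa (C.qa s) xa := by
    simp only [FiniteProb.law, Fintype.sum_prod_type]
    simp only [ite_mk_eq_mk]
    simp only [Finset.sum_ite_irrel, Finset.sum_const_zero, Finset.sum_ite_eq',
      Finset.mem_univ, if_true, policyLaw, ← Finset.mul_sum, (C.chan_mem _ _ _).2, mul_one,
      (π.πb_mem _).2]
  have e3 : FiniteProb.law (C.policyLaw π) (fun ω => (ω.2.2.1, ω.2.1, ω.1)) (xb, xa, s) =
      C.stateLaw s * π.πa (C.qa s) xa * π.πb (C.qb s) xb := by
    simp only [FiniteProb.law, Fintype.sum_prod_type]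
    simp only [ite_mk_eq_mk]
    simp only [Finset.sum_ite_irrel, Finset.sum_const_zero, Finset.sum_ite_eq',
      Finset.mem_univ, if_true, policyLaw, ← Finset.mul_sum, (C.chan_mem _ _ _).2, mul_one]
  have e4 : FiniteProb.law (C.policyLaw π) (fun ω => (ω.2.2.2, ω.2.1, ω.1)) (y, xa, s) =
      C.stateLaw s * π.πa (C.qa s) xa *
        outGiven (π.πb (C.qb s)) (fun b a => C.chan s a b) xa y := by
    simp only [FiniteProb.law, Fintype.sum_prod_type]
    simp only [ite_mk_eq_mk]
    simp only [Finset.sum_ite_irrel, Finset.sum_const_zero, Finset.sum_ite_eq',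
      Finset.mem_univ, if_true, policyLaw, outGiven, Finset.mul_sum]
    exact Finset.sum_congr rfl fun a _ => by ring
  rw [e1, e2, e3, e4]
  simp only [policyLaw]
  by_cases h : C.stateLaw s * π.πa (C.qa s) xa * π.πb (C.qb s) xb * C.chan s xa xb y = 0
  · rw [h, zero_mul, ← mul_assoc, ← mul_assoc, ← mul_assoc, h, zero_mul]
  · obtain ⟨h1, h2, h3, h4⟩ := C.policyLaw_factors_ne_zero π h
    have h5 := outGiven_ne_zero (K := fun b a => C.chan s a b) (π.πb_mem (C.qb s)).1
      (fun b a => C.chan_mem s a b) h3 h4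
    rw [Real.log_mul (by positivity) h4, Real.log_mul (by positivity) h5, Real.log_div h4 h5]
    rw [Real.log_mul (by positivity) h3]
    ring

theorem infoSum_mul_log_two : C.infoSum π * Real.log 2 =
    ∑ s, C.stateLaw s * divBoth (π.πa (C.qa s)) (π.πb (C.qb s)) (C.chan s) := by
  classical
  change FiniteProb.condMutualInfo (C.policyLaw π) (fun ω => (ω.2.1, ω.2.2.1)) (fun ω => ω.2.2.2)
    (fun ω => ω.1) * Real.log 2 = _
  rw [FiniteProb.condMutualInfo_mul_log_two]
  simp only [Fintype.sum_prod_type, divBoth, meanLogRatio, Finset.mul_sum]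
  refine Finset.sum_congr rfl fun s _ => Finset.sum_congr rfl fun xa _ =>
    Finset.sum_congr rfl fun xb _ => Finset.sum_congr rfl fun y _ => ?_
  have e1 : FiniteProb.law (C.policyLaw π) (fun ω => ((ω.2.1, ω.2.2.1), ω.2.2.2, ω.1))
      ((xa, xb), y, s) = C.policyLaw π (s, xa, xb, y) := by
    simp only [FiniteProb.law, Fintype.sum_prod_type]
    simp only [ite_mk_eq_mk]
    simp
  have e2 : FiniteProb.law (C.policyLaw π) (fun ω => ω.1) s = C.stateLaw s := by
    simp only [FiniteProb.law, Fintype.sum_prod_type]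
    rw [Finset.sum_eq_single s (fun t _ ht => by simp [ht]) (by simp)]
    simp only [if_true, policyLaw, ← Finset.mul_sum, (C.chan_mem _ _ _).2, mul_one,
      (π.πb_mem _).2, (π.πa_mem _).2]
  have e3 : FiniteProb.law (C.policyLaw π) (fun ω => ((ω.2.1, ω.2.2.1), ω.1)) ((xa, xb), s) =
      C.stateLaw s * π.πa (C.qa s) xa * π.πb (C.qb s) xb := by
    simp only [FiniteProb.law, Fintype.sum_prod_type]
    simp only [ite_mk_eq_mk]
    simp only [Finset.sum_ite_irrel, Finset.sum_const_zero, Finset.sum_ite_eq',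
      Finset.mem_univ, if_true, policyLaw, ← Finset.mul_sum, (C.chan_mem _ _ _).2, mul_one]
  have e4 : FiniteProb.law (C.policyLaw π) (fun ω => (ω.2.2.2, ω.1)) (y, s) =
      C.stateLaw s * outBoth (π.πa (C.qa s)) (π.πb (C.qb s)) (C.chan s) y := by
    simp only [FiniteProb.law, Fintype.sum_prod_type]
    simp only [ite_mk_eq_mk]
    simp only [Finset.sum_ite_irrel, Finset.sum_const_zero, Finset.sum_ite_eq',
      Finset.mem_univ, if_true, policyLaw, outBoth, Finset.mul_sum]
    exact Finset.sum_congr rfl fun a _ => Finset.sum_congr rfl fun b _ => by ring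
  rw [e1, e2, e3, e4]
  simp only [policyLaw]
  by_cases h : C.stateLaw s * π.πa (C.qa s) xa * π.πb (C.qb s) xb * C.chan s xa xb y = 0
  · rw [h, zero_mul, ← mul_assoc, ← mul_assoc, ← mul_assoc, h, zero_mul]
  · obtain ⟨h1, h2, h3, h4⟩ := C.policyLaw_factors_ne_zero π h
    have h5 := outBoth_ne_zero (π.πa_mem (C.qa s)) (π.πb_mem (C.qb s)).1 (C.chan_mem s) h2 h3 h4
    rw [Real.log_mul (by positivity) h4, Real.log_mul h1 h5, Real.log_div h4 h5]
    ring

theorem infoA_nonneg : 0 ≤ C.infoA π := by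
  refine nonneg_of_mul_nonneg_left ?_ (Real.log_pos one_lt_two)
  rw [infoA_mul_log_two]
  exact Finset.sum_nonneg fun s _ => mul_nonneg (C.stateLaw_mem.1 s)
    (divFirst_nonneg (π.πa_mem _) (π.πb_mem _) (C.chan_mem s))

theorem infoB_nonneg : 0 ≤ C.infoB π := by
  refine nonneg_of_mul_nonneg_left ?_ (Real.log_pos one_lt_two)
  rw [infoB_mul_log_two]
  exact Finset.sum_nonneg fun s _ => mul_nonneg (C.stateLaw_mem.1 s)
    (divSecond_nonneg (π.πa_mem _) (π.πb_mem _) (C.chan_mem s))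

theorem infoA_le_infoSum : C.infoA π ≤ C.infoSum π := by
  refine le_of_mul_le_mul_right ?_ (Real.log_pos one_lt_two)
  rw [infoA_mul_log_two, infoSum_mul_log_two]
  exact Finset.sum_le_sum fun s _ => mul_le_mul_of_nonneg_left
    (divFirst_le_divBoth (π.πa_mem _) (π.πb_mem _) (C.chan_mem s)) (C.stateLaw_mem.1 s)

theorem infoB_le_infoSum : C.infoB π ≤ C.infoSum π := by
  refine le_of_mul_le_mul_right ?_ (Real.log_pos one_lt_two)
  rw [infoB_mul_log_two, infoSum_mul_log_two]
  exact Finset.sum_le_sum fun s _ => mul_le_mul_of_nonneg_left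
    (divSecond_le_divBoth (π.πa_mem _) (π.πb_mem _) (C.chan_mem s)) (C.stateLaw_mem.1 s)

theorem infoSum_le_infoA_add_infoB : C.infoSum π ≤ C.infoA π + C.infoB π := by
  refine le_of_mul_le_mul_right ?_ (Real.log_pos one_lt_two)
  rw [add_mul, infoA_mul_log_two, infoB_mul_log_two, infoSum_mul_log_two,
    ← Finset.sum_add_distrib]
  refine Finset.sum_le_sum fun s _ => ?_
  rw [← mul_add]
  exact mul_le_mul_of_nonneg_left
    (divBoth_le_add (π.πa_mem _) (π.πb_mem _) (C.chan_mem s)) (C.stateLaw_mem.1 s)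

end FSMAC

/-! ### Random coding for a two-user channel -/

/-- The first moment method: some value of a random variable is at most its mean. -/
theorem exists_le_of_mean_le {ι : Type*} [Fintype ι] {w f : ι → ℝ} {B : ℝ}
    (hw : w ∈ stdSimplex ℝ ι) (h : ∑ i, w i * f i ≤ B) : ∃ i, f i ≤ B := by
  by_contra! hlt
  obtain ⟨i, hi⟩ : ∃ i, 0 < w i := by
    by_contra! hle
    have : ∑ i, w i ≤ 0 := Finset.sum_nonpos fun i _ => hle i
    linarith [hw.2]
  have : ∑ i, w i * B < ∑ i, w i * f i :=
    Finset.sum_lt_sum (fun j _ => mul_le_mul_of_nonneg_left (hlt j).le (hw.1 j))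
      ⟨i, Finset.mem_univ i, mul_lt_mul_of_pos_left (hlt i) hi⟩
  rw [← Finset.sum_mul, hw.2, one_mul] at this
  linarith

section Codebooks

variable {ι κ U V : Type*} [Fintype ι] [DecidableEq ι] [Fintype κ] [DecidableEq κ] [Fintype U]
  [Fintype V] {p : U → ℝ} {r : V → ℝ}

/-- The codewords `x a` and `x' b` of independent random codebooks are independent, with the laws of
the ensembles. -/
theorem sum_codebooks_eval (hp : ∑ u, p u = 1) (hr : ∑ v, r v = 1) (a : ι) (b : κ)
    (F : U → V → ℝ) :
    ∑ x : ι → U, ∑ x' : κ → V, (∏ i, p (x i)) * (∏ j, r (x' j)) * F (x a) (x' b) =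
      ∑ u, ∑ v, p u * r v * F u v := by
  simp only [mul_assoc, ← Finset.mul_sum]
  rw [sum_pi_eval (fun _ => p) (fun _ => hp) a
    (fun u => ∑ x' : κ → V, (∏ j, r (x' j)) * F u (x' b))]
  refine Finset.sum_congr rfl fun u _ => ?_
  rw [sum_pi_eval (fun _ => r) (fun _ => hr) b]

theorem sum_codebooks_eval_first (hp : ∑ u, p u = 1) (hr : ∑ v, r v = 1) {a a' : ι}
    (ha : a' ≠ a) (b : κ) (F : U → U → V → ℝ) :
    ∑ x : ι → U, ∑ x' : κ → V, (∏ i, p (x i)) * (∏ j, r (x' j)) * F (x a) (x a') (x' b) =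
      ∑ u, ∑ u', ∑ v, p u * p u' * r v * F u u' v := by
  simp only [mul_assoc, ← Finset.mul_sum]
  rw [sum_pi_eval_two (fun _ => p) (fun _ => hp) ha
    (fun u u' => ∑ x' : κ → V, (∏ j, r (x' j)) * F u u' (x' b))]
  refine Finset.sum_congr rfl fun u _ => ?_
  rw [Finset.mul_sum]
  refine Finset.sum_congr rfl fun u' _ => ?_
  rw [sum_pi_eval (fun _ => r) (fun _ => hr) b, mul_assoc]

theorem sum_codebooks_eval_both (hp : ∑ u, p u = 1) (hr : ∑ v, r v = 1) {a a' : ι}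
    (ha : a' ≠ a) {b b' : κ} (hb : b' ≠ b) (F : U → U → V → V → ℝ) :
    ∑ x : ι → U, ∑ x' : κ → V,
        (∏ i, p (x i)) * (∏ j, r (x' j)) * F (x a) (x a') (x' b) (x' b') =
      ∑ u, ∑ u', ∑ v, ∑ v', p u * p u' * (r v * r v') * F u u' v v' := by
  simp only [mul_assoc, ← Finset.mul_sum]
  rw [sum_pi_eval_two (fun _ => p) (fun _ => hp) ha
    (fun u u' => ∑ x' : κ → V, (∏ j, r (x' j)) * F u u' (x' b) (x' b'))]
  refine Finset.sum_congr rfl fun u _ => ?_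
  rw [Finset.mul_sum]
  refine Finset.sum_congr rfl fun u' _ => ?_
  rw [sum_pi_eval_two (fun _ => r) (fun _ => hr) hb, mul_assoc]
  simp only [Finset.mul_sum, mul_assoc]

end Codebooks

open Classical in
/-- The union bound for the decoder that outputs the only message pair passing a test `T`. -/
theorem exists_decoder {I J Z : Type*} [Fintype I] [Fintype J] [DecidableEq I]
    [DecidableEq J] [Nonempty I] [Nonempty J] (T : I → J → Z → Prop) :
    ∃ dec : Z → I × J, ∀ (w : I × J) (z : Z),
      (if dec z ≠ w then (1 : ℝ) else 0) ≤ (if T w.1 w.2 z then 0 else 1) +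
        ∑ a ∈ Finset.univ.erase w.1, (if T a w.2 z then 1 else 0) +
        ∑ b ∈ Finset.univ.erase w.2, (if T w.1 b z then 1 else 0) +
        ∑ a ∈ Finset.univ.erase w.1, ∑ b ∈ Finset.univ.erase w.2,
          (if T a b z then 1 else 0) := by
  refine ⟨fun z => if h : ∃ w : I × J, T w.1 w.2 z ∧ ∀ w' : I × J, T w'.1 w'.2 z → w' = w then
    h.choose else Classical.arbitrary _, fun w z => ?_⟩
  have i1 : ∀ P : Prop, (0 : ℝ) ≤ if P then 1 else 0 := fun P => by split_ifs <;> norm_num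
  have s1 : 0 ≤ ∑ a ∈ Finset.univ.erase w.1, (if T a w.2 z then (1 : ℝ) else 0) :=
    Finset.sum_nonneg fun _ _ => i1 _
  have s2 : 0 ≤ ∑ b ∈ Finset.univ.erase w.2, (if T w.1 b z then (1 : ℝ) else 0) :=
    Finset.sum_nonneg fun _ _ => i1 _
  have s3 : 0 ≤ ∑ a ∈ Finset.univ.erase w.1, ∑ b ∈ Finset.univ.erase w.2,
      (if T a b z then (1 : ℝ) else 0) :=
    Finset.sum_nonneg fun _ _ => Finset.sum_nonneg fun _ _ => i1 _
  by_cases hT : T w.1 w.2 z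
  · by_cases hu : ∀ w' : I × J, T w'.1 w'.2 z → w' = w
    · have hex : ∃ w : I × J, T w.1 w.2 z ∧ ∀ w' : I × J, T w'.1 w'.2 z → w' = w := ⟨w, hT, hu⟩
      have : hex.choose = w := hu _ hex.choose_spec.1
      simp only [dif_pos hex, this, ne_eq, not_true_eq_false, if_false, hT, if_true]
      linarith
    · push Not at hu
      obtain ⟨⟨a, b⟩, hab, hne⟩ := hu
      have hle : (if (if h : ∃ w : I × J, T w.1 w.2 z ∧ ∀ w' : I × J, T w'.1 w'.2 z → w' = w then
          h.choose else Classical.arbitrary _) ≠ w then (1 : ℝ) else 0) ≤ 1 := by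
        split_ifs <;> norm_num
      refine hle.trans ?_
      rw [if_pos hT]
      dsimp only at hab
      by_cases ha : a = w.1
      · have hb : b ≠ w.2 := fun hb => hne (Prod.ext ha hb)
        rw [ha] at hab
        have := Finset.single_le_sum (f := fun b => if T w.1 b z then (1 : ℝ) else 0)
          (fun _ _ => i1 _) (Finset.mem_erase.2 ⟨hb, Finset.mem_univ b⟩)
        simp only [hab, if_true] at this
        linarith
      · by_cases hb : b = w.2
        · rw [hb] at hab
          have := Finset.single_le_sum (f := fun a => if T a w.2 z then (1 : ℝ) else 0)
            (fun _ _ => i1 _) (Finset.mem_erase.2 ⟨ha, Finset.mem_univ a⟩)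
          simp only [hab, if_true] at this
          linarith
        · have h1 := Finset.single_le_sum (f := fun b => if T a b z then (1 : ℝ) else 0)
            (fun _ _ => i1 _) (Finset.mem_erase.2 ⟨hb, Finset.mem_univ b⟩)
          have h2 := Finset.single_le_sum
            (f := fun a => ∑ b ∈ Finset.univ.erase w.2, if T a b z then (1 : ℝ) else 0)
            (fun _ _ => Finset.sum_nonneg fun _ _ => i1 _)
            (Finset.mem_erase.2 ⟨ha, Finset.mem_univ a⟩)
          simp only [hab, if_true] at h1
          linarith
  · rw [if_neg hT]
    have hle : (if (if h : ∃ w : I × J, T w.1 w.2 z ∧ ∀ w' : I × J, T w'.1 w'.2 z → w' = w then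
        h.choose else Classical.arbitrary _) ≠ w then (1 : ℝ) else 0) ≤ 1 := by
      split_ifs <;> norm_num
    linarith

section RandomCoding

variable {U V Z : Type*} [Fintype U] [Fintype V] [Fintype Z]

/-- The threshold test: the likelihood of `z` given both inputs is at least each of its three averages
over one or both inputs times the factors `exp γa`, `exp γb`, `exp γs`. -/
def PassesTest (p : U → ℝ) (r : V → ℝ) (W : U → V → Z → ℝ) (γa γb γs : ℝ) (u : U) (v : V)
    (z : Z) : Prop :=
  Real.exp γa * outGiven p W v z ≤ W u v z ∧
    Real.exp γb * outGiven r (fun v u => W u v) u z ≤ W u v z ∧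
      Real.exp γs * outBoth p r W z ≤ W u v z

open Classical in
/-- The probability that the transmitted inputs fail the threshold test. -/
noncomputable def testFailure (p : U → ℝ) (r : V → ℝ) (W : U → V → Z → ℝ) (γa γb γs : ℝ) : ℝ :=
  ∑ u, ∑ v, p u * r v * ∑ z, W u v z * if PassesTest p r W γa γb γs u v z then 0 else 1

variable {p : U → ℝ} {r : V → ℝ} {W : U → V → Z → ℝ}

open Classical in
/-- A wrong first codeword, independent of the output given the second one, passes the test with
probability at most `exp (-γa)`. -/
theorem false_first_le (hp : p ∈ stdSimplex ℝ U) (hr : r ∈ stdSimplex ℝ V)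
    (hW : ∀ u v, W u v ∈ stdSimplex ℝ Z) (γa γb γs : ℝ) :
    ∑ u, ∑ u', ∑ v, p u * p u' * r v *
      ∑ z, W u v z * (if PassesTest p r W γa γb γs u' v z then 1 else 0) ≤ Real.exp (-γa) := by
  calc ∑ u, ∑ u', ∑ v, p u * p u' * r v *
        ∑ z, W u v z * (if PassesTest p r W γa γb γs u' v z then 1 else 0)
      = ∑ u', ∑ v, ∑ z, p u' * r v *
          (outGiven p W v z * if PassesTest p r W γa γb γs u' v z then 1 else 0) := by
        rw [Finset.sum_comm]
        refine Finset.sum_congr rfl fun u' _ => ?_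
        rw [Finset.sum_comm]
        refine Finset.sum_congr rfl fun v _ => ?_
        simp only [Finset.mul_sum, outGiven, Finset.sum_mul]
        rw [Finset.sum_comm]
        refine Finset.sum_congr rfl fun z _ => Finset.sum_congr rfl fun u _ => ?_
        ring
    _ ≤ ∑ u', ∑ v, ∑ z, p u' * r v * (Real.exp (-γa) * W u' v z) := by
        refine Finset.sum_le_sum fun u' _ => Finset.sum_le_sum fun v _ =>
          Finset.sum_le_sum fun z _ =>
            mul_le_mul_of_nonneg_left ?_ (mul_nonneg (hp.1 u') (hr.1 v))
        split_ifs with h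
        · rw [mul_one, Real.exp_neg, inv_mul_eq_div, le_div_iff₀ (Real.exp_pos _), mul_comm]
          exact h.1
        · rw [mul_zero]
          exact mul_nonneg (Real.exp_pos _).le ((hW u' v).1 z)
    _ = Real.exp (-γa) := by
        simp only [← Finset.mul_sum, (hW _ _).2, mul_one]
        simp only [← Finset.sum_mul, ← Finset.mul_sum, hr.2, hp.2, mul_one, one_mul]

open Classical in
theorem false_second_le (hp : p ∈ stdSimplex ℝ U) (hr : r ∈ stdSimplex ℝ V)
    (hW : ∀ u v, W u v ∈ stdSimplex ℝ Z) (γa γb γs : ℝ) :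
    ∑ v, ∑ v', ∑ u, r v * r v' * p u *
      ∑ z, W u v z * (if PassesTest p r W γa γb γs u v' z then 1 else 0) ≤ Real.exp (-γb) := by
  refine le_trans (le_of_eq ?_) (false_first_le (W := fun v u => W u v) hr hp
    (fun v u => hW u v) γb γa γs)
  have : ∀ u v' z, PassesTest r p (fun v u => W u v) γb γa γs v' u z ↔
      PassesTest p r W γa γb γs u v' z := by
    intro u v' z
    unfold PassesTest
    rw [outBoth_swap]
    tauto
  simp only [this]

open Classical in
/-- A pair of wrong codewords, independent of the output, passes the test with probability at most
`exp (-γs)`. -/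
theorem false_both_le (hp : p ∈ stdSimplex ℝ U) (hr : r ∈ stdSimplex ℝ V)
    (hW : ∀ u v, W u v ∈ stdSimplex ℝ Z) (γa γb γs : ℝ) :
    ∑ u, ∑ u', ∑ v, ∑ v', p u * p u' * (r v * r v') *
      ∑ z, W u v z * (if PassesTest p r W γa γb γs u' v' z then 1 else 0) ≤ Real.exp (-γs) := by
  calc ∑ u, ∑ u', ∑ v, ∑ v', p u * p u' * (r v * r v') *
        ∑ z, W u v z * (if PassesTest p r W γa γb γs u' v' z then 1 else 0)
      = ∑ u', ∑ v', ∑ z, p u' * r v' *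
          (outBoth p r W z * if PassesTest p r W γa γb γs u' v' z then 1 else 0) := by
        rw [Finset.sum_comm]
        refine Finset.sum_congr rfl fun u' _ => ?_
        simp only [Finset.mul_sum, outBoth, Finset.sum_mul]
        rw [Finset.sum_congr rfl fun u _ => Finset.sum_comm, Finset.sum_comm]
        refine Finset.sum_congr rfl fun v' _ => ?_
        rw [Finset.sum_congr rfl fun u _ => Finset.sum_comm, Finset.sum_comm]
        refine Finset.sum_congr rfl fun z _ => Finset.sum_congr rfl fun u _ =>
          Finset.sum_congr rfl fun v _ => ?_
        ring
    _ ≤ ∑ u', ∑ v, ∑ z, p u' * r v * (Real.exp (-γs) * W u' v z) := by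
        refine Finset.sum_le_sum fun u' _ => Finset.sum_le_sum fun v _ =>
          Finset.sum_le_sum fun z _ =>
            mul_le_mul_of_nonneg_left ?_ (mul_nonneg (hp.1 u') (hr.1 v))
        split_ifs with h
        · rw [mul_one, Real.exp_neg, inv_mul_eq_div, le_div_iff₀ (Real.exp_pos _), mul_comm]
          exact h.2.2
        · rw [mul_zero]
          exact mul_nonneg (Real.exp_pos _).le ((hW u' v).1 z)
    _ = Real.exp (-γs) := by
        simp only [← Finset.mul_sum, (hW _ _).2, mul_one]
        simp only [← Finset.sum_mul, ← Finset.mul_sum, hr.2, hp.2, mul_one, one_mul]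

theorem sum_erase_const {ι : Type*} [Fintype ι] [DecidableEq ι] (i : ι) (c : ℝ) :
    ∑ _j ∈ Finset.univ.erase i, c = ((Fintype.card ι : ℝ) - 1) * c := by
  rw [Finset.sum_const, Finset.card_erase_of_mem (Finset.mem_univ i), Finset.card_univ,
    nsmul_eq_mul, Nat.cast_sub (Fintype.card_pos_iff.2 ⟨i⟩), Nat.cast_one]

/-- One-shot random coding: with codewords drawn independently from `p` and `r`, some codebook
together with the threshold decoder has average error probability at most the probability that the
true pair fails the test plus the union bound over the wrong pairs. -/
theorem exists_code_of_thresholds (hp : p ∈ stdSimplex ℝ U) (hr : r ∈ stdSimplex ℝ V)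
    (hW : ∀ u v, W u v ∈ stdSimplex ℝ Z) (γa γb γs : ℝ) {Ma Mb : ℕ} (hMa : 0 < Ma)
    (hMb : 0 < Mb) :
    ∃ (x : Fin Ma → U) (x' : Fin Mb → V) (dec : Z → Fin Ma × Fin Mb),
      ∑ w : Fin Ma × Fin Mb, 1 / (Ma : ℝ) * (1 / (Mb : ℝ)) *
          ∑ z, (if dec z ≠ w then W (x w.1) (x' w.2) z else 0) ≤
        testFailure p r W γa γb γs + ((Ma : ℝ) - 1) * Real.exp (-γa) +
          ((Mb : ℝ) - 1) * Real.exp (-γb) +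
          ((Ma : ℝ) - 1) * ((Mb : ℝ) - 1) * Real.exp (-γs) := by
  classical
  have : Nonempty (Fin Ma) := ⟨⟨0, hMa⟩⟩
  have : Nonempty (Fin Mb) := ⟨⟨0, hMb⟩⟩
  set T := PassesTest p r W γa γb γs with hT
  have hdec := fun (x : Fin Ma → U) (x' : Fin Mb → V) =>
    exists_decoder fun (a : Fin Ma) (b : Fin Mb) (z : Z) => T (x a) (x' b) z
  choose dec hdec using hdec
  set good : U → V → ℝ := fun u v => ∑ z, W u v z * if T u v z then 0 else 1 with hgood
  set bad : U → V → U → V → ℝ := fun u v u' v' =>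
    ∑ z, W u v z * if T u' v' z then 1 else 0 with hbad
  -- The union bound on the error probability of the message pair `w`, for a fixed codebook.
  set err : (Fin Ma → U) → (Fin Mb → V) → Fin Ma × Fin Mb → ℝ := fun x x' w =>
    good (x w.1) (x' w.2) +
      ∑ a ∈ Finset.univ.erase w.1, bad (x w.1) (x' w.2) (x a) (x' w.2) +
      ∑ b ∈ Finset.univ.erase w.2, bad (x w.1) (x' w.2) (x w.1) (x' b) +
      ∑ a ∈ Finset.univ.erase w.1, ∑ b ∈ Finset.univ.erase w.2,
        bad (x w.1) (x' w.2) (x a) (x' b) with herr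
  have herr_le : ∀ x x' w,
      ∑ z, (if dec x x' z ≠ w then W (x w.1) (x' w.2) z else 0) ≤ err x x' w := by
    intro x x' w
    have h1 : ∀ z, (if dec x x' z ≠ w then W (x w.1) (x' w.2) z else 0) ≤
        W (x w.1) (x' w.2) z * ((if T (x w.1) (x' w.2) z then 0 else 1) +
        ∑ a ∈ Finset.univ.erase w.1, (if T (x a) (x' w.2) z then 1 else 0) +
        ∑ b ∈ Finset.univ.erase w.2, (if T (x w.1) (x' b) z then 1 else 0) +
        ∑ a ∈ Finset.univ.erase w.1, ∑ b ∈ Finset.univ.erase w.2,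
          (if T (x a) (x' b) z then 1 else 0)) := fun z => by
      have h2 := mul_le_mul_of_nonneg_left (hdec x x' w z) ((hW (x w.1) (x' w.2)).1 z)
      rw [mul_ite, mul_one, mul_zero] at h2
      exact h2
    refine (Finset.sum_le_sum fun z _ => h1 z).trans (le_of_eq ?_)
    simp only [herr, hgood, hbad, mul_add, Finset.sum_add_distrib, Finset.mul_sum]
    congr 1
    · congr 1
      · congr 1
        exact Finset.sum_comm
      · exact Finset.sum_comm
    · rw [Finset.sum_comm]
      exact Finset.sum_congr rfl fun a _ => Finset.sum_comm
  set wt : (Fin Ma → U) → (Fin Mb → V) → ℝ := fun x x' => (∏ i, p (x i)) * ∏ j, r (x' j) with hwt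
  -- The expectation of the union bound over the codebook.
  have hmean : ∀ w, ∑ x, ∑ x', wt x x' * err x x' w ≤
      testFailure p r W γa γb γs + ((Ma : ℝ) - 1) * Real.exp (-γa) +
          ((Mb : ℝ) - 1) * Real.exp (-γb) +
          ((Ma : ℝ) - 1) * ((Mb : ℝ) - 1) * Real.exp (-γs) := by
    intro w
    simp only [herr, mul_add, Finset.sum_add_distrib]
    refine add_le_add (add_le_add (add_le_add ?_ ?_) ?_) ?_
    · exact (sum_codebooks_eval hp.2 hr.2 w.1 w.2 good).le
    · have h1 : ∀ a ∈ Finset.univ.erase w.1,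
          ∑ x, ∑ x', wt x x' * bad (x w.1) (x' w.2) (x a) (x' w.2) ≤ Real.exp (-γa) := by
        intro a ha
        simp only [hwt]
        rw [sum_codebooks_eval_first hp.2 hr.2 (Finset.ne_of_mem_erase ha) w.2
          (fun u u' v => bad u v u' v)]
        exact false_first_le hp hr hW γa γb γs
      have h2 := Finset.sum_le_sum h1
      rw [sum_erase_const, Fintype.card_fin] at h2
      refine le_trans (le_of_eq ?_) h2
      simp only [Finset.mul_sum]
      rw [Finset.sum_congr rfl fun x _ => Finset.sum_comm, Finset.sum_comm]
    · have h1 : ∀ b ∈ Finset.univ.erase w.2,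
          ∑ x, ∑ x', wt x x' * bad (x w.1) (x' w.2) (x w.1) (x' b) ≤ Real.exp (-γb) := by
        intro b hb
        have := sum_codebooks_eval_first hr.2 hp.2 (Finset.ne_of_mem_erase hb) w.1
          (fun v v' u => bad u v u v')
        rw [Finset.sum_comm]
        simp only [hwt, mul_comm (∏ i, p _)]
        rw [this]
        exact false_second_le hp hr hW γa γb γs
      have h2 := Finset.sum_le_sum h1
      rw [sum_erase_const, Fintype.card_fin] at h2
      refine le_trans (le_of_eq ?_) h2
      simp only [Finset.mul_sum]
      rw [Finset.sum_congr rfl fun x _ => Finset.sum_comm, Finset.sum_comm]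
    · have h1 : ∀ a ∈ Finset.univ.erase w.1, ∑ b ∈ Finset.univ.erase w.2,
          ∑ x, ∑ x', wt x x' * bad (x w.1) (x' w.2) (x a) (x' b) ≤
            ((Mb : ℝ) - 1) * Real.exp (-γs) := by
        intro a ha
        have h0 : ∀ b ∈ Finset.univ.erase w.2,
            ∑ x, ∑ x', wt x x' * bad (x w.1) (x' w.2) (x a) (x' b) ≤ Real.exp (-γs) := by
          intro b hb
          simp only [hwt]
          rw [sum_codebooks_eval_both hp.2 hr.2 (Finset.ne_of_mem_erase ha)
            (Finset.ne_of_mem_erase hb) (fun u u' v v' => bad u v u' v')]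
          exact false_both_le hp hr hW γa γb γs
        have h2 := Finset.sum_le_sum h0
        rwa [sum_erase_const, Fintype.card_fin] at h2
      have h2 := Finset.sum_le_sum h1
      rw [sum_erase_const, Fintype.card_fin, ← mul_assoc] at h2
      refine le_trans (le_of_eq ?_) h2
      simp only [Finset.mul_sum]
      rw [Finset.sum_congr rfl fun x _ => Finset.sum_comm, Finset.sum_comm]
      refine Finset.sum_congr rfl fun a _ => ?_
      rw [Finset.sum_congr rfl fun x _ => Finset.sum_comm, Finset.sum_comm]
  have hMa' : (Ma : ℝ) ≠ 0 := by exact_mod_cast hMa.ne'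
  have hMb' : (Mb : ℝ) ≠ 0 := by exact_mod_cast hMb.ne'
  have hwt_mem : (fun c : (Fin Ma → U) × (Fin Mb → V) => wt c.1 c.2) ∈ stdSimplex ℝ _ := by
    refine ⟨fun c => mul_nonneg (Finset.prod_nonneg fun i _ => hp.1 _)
      (Finset.prod_nonneg fun j _ => hr.1 _), ?_⟩
    rw [Fintype.sum_prod_type]
    simp only [hwt, ← Finset.mul_sum]
    rw [sum_pi_prod (fun _ : Fin Mb => r) fun _ => hr.2]
    simp only [mul_one]
    exact sum_pi_prod (fun _ : Fin Ma => p) fun _ => hp.2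
  obtain ⟨⟨x, x'⟩, hx⟩ := exists_le_of_mean_le hwt_mem
    (f := fun c => ∑ w : Fin Ma × Fin Mb, 1 / (Ma : ℝ) * (1 / (Mb : ℝ)) * err c.1 c.2 w)
    (B := testFailure p r W γa γb γs + ((Ma : ℝ) - 1) * Real.exp (-γa) +
          ((Mb : ℝ) - 1) * Real.exp (-γb) +
          ((Ma : ℝ) - 1) * ((Mb : ℝ) - 1) * Real.exp (-γs)) (by
      simp only [Finset.mul_sum]
      rw [Finset.sum_comm]
      calc _ = ∑ w : Fin Ma × Fin Mb, 1 / (Ma : ℝ) * (1 / (Mb : ℝ)) *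
            ∑ x, ∑ x', wt x x' * err x x' w := by
            refine Finset.sum_congr rfl fun w _ => ?_
            rw [Fintype.sum_prod_type]
            simp only [Finset.mul_sum]
            refine Finset.sum_congr rfl fun x _ => Finset.sum_congr rfl fun x' _ => ?_
            ring
        _ ≤ ∑ w : Fin Ma × Fin Mb, 1 / (Ma : ℝ) * (1 / (Mb : ℝ)) * _ :=
            Finset.sum_le_sum fun w _ => mul_le_mul_of_nonneg_left (hmean w) (by positivity)
        _ = _ := by
            rw [Finset.sum_const, Finset.card_univ, Fintype.card_prod, Fintype.card_fin,
              Fintype.card_fin, nsmul_eq_mul]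
            push_cast
            field_simp)
  refine ⟨x, x', dec x x', le_trans (Finset.sum_le_sum fun w _ => ?_) hx⟩
  exact mul_le_mul_of_nonneg_left (herr_le x x' w) (by positivity)

end RandomCoding

/-! ### Blocks of letters with random time sharing -/

theorem exp_mul_prod_le_prod {ι : Type*} [Fintype ι] {a b : ι → ℝ} (ha : ∀ i, 0 < a i)
    (hb : ∀ i, 0 < b i) {c : ℝ}
    (h : c ≤ ∑ i, Real.log (a i / b i)) : Real.exp c * ∏ i, b i ≤ ∏ i, a i := by
  have h1 : Real.exp c ≤ ∏ i, a i / b i := by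
    refine (Real.exp_le_exp.2 h).trans (le_of_eq ?_)
    rw [Real.exp_sum]
    exact Finset.prod_congr rfl fun i _ => Real.exp_log (div_pos (ha i) (hb i))
  rw [Finset.prod_div_distrib, le_div_iff₀ (Finset.prod_pos fun i _ => hb i)] at h1
  exact h1

section Blocks

variable {ι U V Z : Type*} [Fintype ι] [DecidableEq ι] [Fintype U]

theorem prod_pi_mem_stdSimplex {α : Type*} [Fintype α] {p : ι → α → ℝ}
    (hp : ∀ i, p i ∈ stdSimplex ℝ α) : (fun f : ι → α => ∏ i, p i (f i)) ∈ stdSimplex ℝ _ :=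
  ⟨fun _ => Finset.prod_nonneg fun i _ => (hp i).1 _, sum_pi_prod p fun i => (hp i).2⟩

theorem outGiven_pi (p : ι → U → ℝ) (W : U → V → Z → ℝ) (v : ι → V) (z : ι → Z) :
    outGiven (fun u : ι → U => ∏ i, p i (u i)) (fun u v z => ∏ i, W (u i) (v i) (z i)) v z =
      ∏ i, outGiven (p i) W (v i) (z i) := by
  unfold outGiven
  rw [Finset.prod_univ_sum, Fintype.piFinset_univ]
  simp only [Finset.prod_mul_distrib]

variable [Fintype V]

theorem outBoth_pi (p : ι → U → ℝ) (r : ι → V → ℝ) (W : U → V → Z → ℝ) (z : ι → Z) :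
    outBoth (fun u : ι → U => ∏ i, p i (u i)) (fun v : ι → V => ∏ i, r i (v i))
        (fun u v z => ∏ i, W (u i) (v i) (z i)) z =
      ∏ i, outBoth (p i) (r i) W (z i) := by
  simp only [outBoth_eq_sum_outGiven, outGiven_pi]
  rw [Finset.prod_univ_sum, Fintype.piFinset_univ]
  simp only [Finset.prod_mul_distrib]

/-- If the time-sharing letters are drawn i.i.d. from `lam` and thresholds grow at rates below the
mean log-ratios, the true inputs fail the test with probability `O(1 / n)`, by Chebyshev's
inequality; so some time-sharing sequence does at least as well. -/
theorem exists_timeSharing_testFailure_le {Q : Type*} [Fintype Q] [Fintype Z] {lam : Q → ℝ}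
    (hlam : lam ∈ stdSimplex ℝ Q) {p : Q → U → ℝ} (hp : ∀ q, p q ∈ stdSimplex ℝ U)
    {r : Q → V → ℝ} (hr : ∀ q, r q ∈ stdSimplex ℝ V) {W : U → V → Z → ℝ}
    (hW : ∀ u v, W u v ∈ stdSimplex ℝ Z) {γa γb γs : ℝ}
    (ha : γa < ∑ q, lam q * divFirst (p q) (r q) W)
    (hb : γb < ∑ q, lam q * divSecond (p q) (r q) W)
    (hs : γs < ∑ q, lam q * divBoth (p q) (r q) W) :
    ∃ K : ℝ, ∀ n : ℕ, 1 ≤ n → ∃ q : Fin n → Q,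
      testFailure (fun u : Fin n → U => ∏ t, p (q t) (u t))
        (fun v : Fin n → V => ∏ t, r (q t) (v t))
        (fun u v (z : Fin n → Z) => ∏ t, W (u t) (v t) (z t))
        (n * γa) (n * γb) (n * γs) ≤ K / n := by
  classical
  set ℓ : Q × U × V × Z → ℝ := fun ω =>
    lam ω.1 * (p ω.1 ω.2.1 * r ω.1 ω.2.2.1 * W ω.2.1 ω.2.2.1 ω.2.2.2) with hℓ
  set ga : Q × U × V × Z → ℝ := fun ω =>
    Real.log (W ω.2.1 ω.2.2.1 ω.2.2.2 / outGiven (p ω.1) W ω.2.2.1 ω.2.2.2) with hga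
  set gb : Q × U × V × Z → ℝ := fun ω =>
    Real.log (W ω.2.1 ω.2.2.1 ω.2.2.2 / outGiven (r ω.1) (fun v u => W u v) ω.2.1 ω.2.2.2) with hgb
  set gs : Q × U × V × Z → ℝ := fun ω =>
    Real.log (W ω.2.1 ω.2.2.1 ω.2.2.2 / outBoth (p ω.1) (r ω.1) W ω.2.2.2) with hgs
  have hℓ0 : ∀ ω, 0 ≤ ℓ ω := fun ω => mul_nonneg (hlam.1 _)
    (mul_nonneg (mul_nonneg ((hp _).1 _) ((hr _).1 _)) ((hW _ _).1 _))
  have hℓ1 : ∑ ω, ℓ ω = 1 := by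
    simp only [hℓ, Fintype.sum_prod_type, ← Finset.mul_sum]
    simp only [(hW _ _).2, mul_one, ← Finset.mul_sum, (hr _).2, (hp _).2, hlam.2]
  have hma : ∑ q, lam q * divFirst (p q) (r q) W = ∑ ω, ℓ ω * ga ω := by
    simp only [hℓ, hga, Fintype.sum_prod_type, divFirst, meanLogRatio, Finset.mul_sum, mul_assoc]
  have hmb : ∑ q, lam q * divSecond (p q) (r q) W = ∑ ω, ℓ ω * gb ω := by
    simp only [hℓ, hgb, Fintype.sum_prod_type, divSecond, meanLogRatio, Finset.mul_sum, mul_assoc]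
  have hms : ∑ q, lam q * divBoth (p q) (r q) W = ∑ ω, ℓ ω * gs ω := by
    simp only [hℓ, hgs, Fintype.sum_prod_type, divBoth, meanLogRatio, Finset.mul_sum, mul_assoc]
  rw [hma] at ha
  rw [hmb] at hb
  rw [hms] at hs
  refine ⟨(∑ ω, ℓ ω * (ga ω - ∑ ω', ℓ ω' * ga ω') ^ 2) / (∑ ω, ℓ ω * ga ω - γa) ^ 2 +
    (∑ ω, ℓ ω * (gb ω - ∑ ω', ℓ ω' * gb ω') ^ 2) / (∑ ω, ℓ ω * gb ω - γb) ^ 2 +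
    (∑ ω, ℓ ω * (gs ω - ∑ ω', ℓ ω' * gs ω') ^ 2) / (∑ ω, ℓ ω * gs ω - γs) ^ 2,
    fun n hn => ?_⟩
  refine exists_le_of_mean_le (prod_pi_mem_stdSimplex fun _ : Fin n => hlam) ?_
  rw [add_div, add_div]
  refine le_trans ?_ (add_le_add (add_le_add (sum_pi_lower_tail ℓ hℓ0 hℓ1 ga ha n hn)
    (sum_pi_lower_tail ℓ hℓ0 hℓ1 gb hb n hn)) (sum_pi_lower_tail ℓ hℓ0 hℓ1 gs hs n hn))
  simp only [← Finset.sum_add_distrib, ← mul_add]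
  simp only [sum_pi_prod_type, testFailure, Finset.mul_sum]
  refine Finset.sum_le_sum fun q _ => Finset.sum_le_sum fun u _ => Finset.sum_le_sum fun v _ =>
    Finset.sum_le_sum fun z _ => ?_
  set D := ∏ t, ℓ (q t, u t, v t, z t) with hD
  have hDeq : D = (∏ t, lam (q t)) * ((∏ t, p (q t) (u t)) * (∏ t, r (q t) (v t)) *
      ∏ t, W (u t) (v t) (z t)) := by
    simp only [hD, hℓ, Finset.prod_mul_distrib]
  have hD0 : 0 ≤ D := Finset.prod_nonneg fun t _ => hℓ0 _
  have i1 : ∀ P : Prop, (0 : ℝ) ≤ if P then 1 else 0 := fun P => by split_ifs <;> norm_num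
  have hone : ∀ P₁ P₂ P₃ : Prop, ¬(¬P₁ ∧ ¬P₂ ∧ ¬P₃) →
      (1 : ℝ) ≤ (if P₁ then 1 else 0) + (if P₂ then 1 else 0) + if P₃ then 1 else 0 := by
    intro P₁ P₂ P₃ h
    by_cases h1 : P₁ <;> by_cases h2 : P₂ <;> by_cases h3 : P₃ <;> simp_all
  rw [← mul_assoc _ (∏ t, W (u t) (v t) (z t)), ← mul_assoc, ← hDeq]
  rcases hD0.eq_or_lt with h0 | hpos
  · rw [← h0, zero_mul, zero_mul]
  refine mul_le_mul_of_nonneg_left ?_ hD0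
  by_cases hpass : PassesTest (fun u : Fin n → U => ∏ t, p (q t) (u t))
      (fun v : Fin n → V => ∏ t, r (q t) (v t))
      (fun u v (z : Fin n → Z) => ∏ t, W (u t) (v t) (z t)) (n * γa) (n * γb) (n * γs) u v z
  · rw [if_pos hpass]
    exact add_nonneg (add_nonneg (i1 _) (i1 _)) (i1 _)
  rw [if_neg hpass]
  -- A pair that fails the test has one of the three sums below its threshold.
  refine hone _ _ _ fun ⟨h1, h2, h3⟩ => hpass ?_
  have hℓt : ∀ t, ℓ (q t, u t, v t, z t) ≠ 0 := fun t h =>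
    hpos.ne' (Finset.prod_eq_zero (Finset.mem_univ t) h)
  have hWt : ∀ t, W (u t) (v t) (z t) ≠ 0 := fun t =>
    right_ne_zero_of_mul (right_ne_zero_of_mul (hℓt t))
  have hpt : ∀ t, p (q t) (u t) ≠ 0 := fun t =>
    left_ne_zero_of_mul (left_ne_zero_of_mul (right_ne_zero_of_mul (hℓt t)))
  have hrt : ∀ t, r (q t) (v t) ≠ 0 := fun t =>
    right_ne_zero_of_mul (left_ne_zero_of_mul (right_ne_zero_of_mul (hℓt t)))
  have hW0 : ∀ t, 0 < W (u t) (v t) (z t) := fun t => ((hW _ _).1 _).lt_of_ne' (hWt t)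
  refine ⟨?_, ?_, ?_⟩
  · rw [outGiven_pi (fun t => p (q t))]
    refine exp_mul_prod_le_prod hW0 (fun t => ?_) (not_lt.1 h1)
    exact ((outGiven_mem (hp _) hW _).1 _).lt_of_ne' (outGiven_ne_zero (hp _).1 hW (hpt t) (hWt t))
  · rw [outGiven_pi (fun t => r (q t)) (fun v u => W u v)]
    refine exp_mul_prod_le_prod hW0 (fun t => ?_) (not_lt.1 h2)
    exact ((outGiven_mem (K := fun v u => W u v) (hr _) (fun v u => hW u v) _).1 _).lt_of_ne'
      (outGiven_ne_zero (K := fun v u => W u v) (hr _).1 (fun v u => hW u v) (hrt t) (hWt t))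
  · rw [outBoth_pi (fun t => p (q t)) (fun t => r (q t))]
    refine exp_mul_prod_le_prod hW0 (fun t => ?_) (not_lt.1 h3)
    exact ((outBoth_mem (hp _) (hr _) hW).1 _).lt_of_ne'
      (outBoth_ne_zero (hp _) (hr _).1 hW (hpt t) (hrt t) (hWt t))

end Blocks

/-! ### Shannon strategies -/

namespace FSMAC

variable {S Va Vb Xa Xb Y : Type*} [Fintype S] [Fintype Y]
  (C : FSMAC S Va Vb Xa Xb Y)

/-- The channel without encoder state information whose input letters are Shannon strategies, that
is, functions from states to inputs, and whose output is the state together with the output. A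
strategy is evaluated at the representative `ρa (qa s)` of the states that the encoder cannot tell
from `s`; this keeps the alphabet finite although `Va` need not be. -/
def strategyChannel (ρa : Va → S) (ρb : Vb → S) (u : S → Xa) (v : S → Xb) (z : S × Y) : ℝ :=
  C.stateLaw z.1 * C.chan z.1 (u (ρa (C.qa z.1))) (v (ρb (C.qb z.1))) z.2

theorem strategyChannel_mem (ρa : Va → S) (ρb : Vb → S) (u : S → Xa) (v : S → Xb) :
    C.strategyChannel ρa ρb u v ∈ stdSimplex ℝ (S × Y) := by
  refine ⟨fun z => mul_nonneg (C.stateLaw_mem.1 _) ((C.chan_mem _ _ _).1 _), ?_⟩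
  simp only [strategyChannel, Fintype.sum_prod_type, ← Finset.mul_sum, (C.chan_mem _ _ _).2,
    mul_one, C.stateLaw_mem.2]

/-- The block code that, at each time, evaluates the strategy prescribed by the codeword at the
current quantized observation. -/
def strategyCode (ρa : Va → S) (ρb : Vb → S) {n Ma Mb : ℕ} (x : Fin Ma → Fin n → S → Xa)
    (x' : Fin Mb → Fin n → S → Xb) (dec : (Fin n → S × Y) → Fin Ma × Fin Mb) :
    BlockCode S Va Vb Xa Xb Y n Ma Mb where
  encA t w h := x w t (ρa (h (Fin.last t)))
  encB t w h := x' w t (ρb (h (Fin.last t)))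
  dec s y := dec fun t => (s t, y t)

variable [Fintype Xa] [Fintype Xb] [DecidableEq S]
  (π : TeamPolicy Va Vb Xa Xb) {ρa : Va → S} {ρb : Vb → S}

theorem meanLogRatio_strategyChannel (hρa : ∀ s, C.qa (ρa (C.qa s)) = C.qa s)
    (hρb : ∀ s, C.qb (ρb (C.qb s)) = C.qb s) (q : S → Xa → Xb → Y → ℝ) :
    meanLogRatio (fun u : S → Xa => ∏ s, π.πa (C.qa s) (u s))
        (fun v : S → Xb => ∏ s, π.πb (C.qb s) (v s)) (C.strategyChannel ρa ρb)
        (fun u v z => C.stateLaw z.1 * q z.1 (u (ρa (C.qa z.1))) (v (ρb (C.qb z.1))) z.2) =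
      ∑ s, C.stateLaw s * meanLogRatio (π.πa (C.qa s)) (π.πb (C.qb s)) (C.chan s) (q s) := by
  calc _ = ∑ u : S → Xa, ∑ v : S → Xb, ∑ s, ∑ y, (∏ s, π.πa (C.qa s) (u s)) *
          (∏ s, π.πb (C.qb s) (v s)) * (C.stateLaw s *
            (C.chan s (u (ρa (C.qa s))) (v (ρb (C.qb s))) y *
            Real.log (C.chan s (u (ρa (C.qa s))) (v (ρb (C.qb s))) y /
              q s (u (ρa (C.qa s))) (v (ρb (C.qb s))) y))) := by
        simp only [meanLogRatio, Fintype.sum_prod_type]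
        refine Finset.sum_congr rfl fun u _ => Finset.sum_congr rfl fun v _ =>
          Finset.sum_congr rfl fun s _ => Finset.sum_congr rfl fun y _ => ?_
        by_cases hs : C.stateLaw s = 0
        · simp [strategyChannel, hs]
        · simp only [strategyChannel, mul_div_mul_left _ _ hs]
          ring
    _ = ∑ s, ∑ y, ∑ u : S → Xa, ∑ v : S → Xb, (∏ s, π.πa (C.qa s) (u s)) *
          (∏ s, π.πb (C.qb s) (v s)) * (C.stateLaw s *
            (C.chan s (u (ρa (C.qa s))) (v (ρb (C.qb s))) y *
            Real.log (C.chan s (u (ρa (C.qa s))) (v (ρb (C.qb s))) y /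
              q s (u (ρa (C.qa s))) (v (ρb (C.qb s))) y))) := by
        rw [Finset.sum_congr rfl fun u _ => Finset.sum_comm, Finset.sum_comm]
        refine Finset.sum_congr rfl fun s _ => ?_
        rw [Finset.sum_congr rfl fun u _ => Finset.sum_comm, Finset.sum_comm]
    _ = ∑ s, ∑ y, ∑ a, ∑ b, π.πa (C.qa s) a * π.πb (C.qb s) b * (C.stateLaw s *
            (C.chan s a b y * Real.log (C.chan s a b y / q s a b y))) := by
        refine Finset.sum_congr rfl fun s _ => Finset.sum_congr rfl fun y _ => ?_
        simp only [mul_assoc, ← Finset.mul_sum]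
        have hb : ∀ a, ∑ v : S → Xb, (∏ s, π.πb (C.qb s) (v s)) * (C.stateLaw s *
            (C.chan s a (v (ρb (C.qb s))) y * Real.log (C.chan s a (v (ρb (C.qb s))) y /
              q s a (v (ρb (C.qb s))) y))) = ∑ b, π.πb (C.qb s) b * (C.stateLaw s *
            (C.chan s a b y * Real.log (C.chan s a b y / q s a b y))) := fun a => by
          rw [sum_pi_eval (fun s => π.πb (C.qb s)) (fun s => (π.πb_mem _).2) (ρb (C.qb s))
            (fun b => C.stateLaw s * (C.chan s a b y * Real.log (C.chan s a b y / q s a b y))),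
            hρb]
        simp only [hb]
        rw [sum_pi_eval (fun s => π.πa (C.qa s)) (fun s => (π.πa_mem _).2) (ρa (C.qa s))
          (fun a => ∑ b, π.πb (C.qb s) b * (C.stateLaw s *
            (C.chan s a b y * Real.log (C.chan s a b y / q s a b y)))), hρa]
    _ = _ := by
        simp only [meanLogRatio, Finset.mul_sum]
        refine Finset.sum_congr rfl fun s _ => ?_
        rw [Finset.sum_comm]
        refine Finset.sum_congr rfl fun a _ => ?_
        rw [Finset.sum_comm]
        refine Finset.sum_congr rfl fun b _ => Finset.sum_congr rfl fun y _ => ?_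
        ring

theorem outGiven_strategyChannel (hρa : ∀ s, C.qa (ρa (C.qa s)) = C.qa s) (v : S → Xb)
    (z : S × Y) :
    outGiven (fun u : S → Xa => ∏ s, π.πa (C.qa s) (u s)) (C.strategyChannel ρa ρb) v z =
      C.stateLaw z.1 *
        outGiven (π.πa (C.qa z.1)) (C.chan z.1) (v (ρb (C.qb z.1))) z.2 := by
  unfold outGiven strategyChannel
  rw [sum_pi_eval (fun s => π.πa (C.qa s)) (fun s => (π.πa_mem _).2) (ρa (C.qa z.1))
    (fun a => C.stateLaw z.1 * C.chan z.1 a (v (ρb (C.qb z.1))) z.2), hρa, Finset.mul_sum]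
  exact Finset.sum_congr rfl fun a _ => by ring

theorem outGiven_strategyChannel_swap (hρb : ∀ s, C.qb (ρb (C.qb s)) = C.qb s) (u : S → Xa)
    (z : S × Y) :
    outGiven (fun v : S → Xb => ∏ s, π.πb (C.qb s) (v s))
        (fun v u => C.strategyChannel ρa ρb u v) u z =
      C.stateLaw z.1 *
        outGiven (π.πb (C.qb z.1)) (fun b a => C.chan z.1 a b) (u (ρa (C.qa z.1))) z.2 := by
  unfold outGiven strategyChannel
  rw [sum_pi_eval (fun s => π.πb (C.qb s)) (fun s => (π.πb_mem _).2) (ρb (C.qb z.1))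
    (fun b => C.stateLaw z.1 * C.chan z.1 (u (ρa (C.qa z.1))) b z.2), hρb, Finset.mul_sum]
  exact Finset.sum_congr rfl fun a _ => by ring

theorem outBoth_strategyChannel (hρa : ∀ s, C.qa (ρa (C.qa s)) = C.qa s)
    (hρb : ∀ s, C.qb (ρb (C.qb s)) = C.qb s) (z : S × Y) :
    outBoth (fun u : S → Xa => ∏ s, π.πa (C.qa s) (u s))
        (fun v : S → Xb => ∏ s, π.πb (C.qb s) (v s)) (C.strategyChannel ρa ρb) z =
      C.stateLaw z.1 * outBoth (π.πa (C.qa z.1)) (π.πb (C.qb z.1)) (C.chan z.1) z.2 := by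
  simp only [outBoth_eq_sum_outGiven, C.outGiven_strategyChannel π hρa]
  rw [sum_pi_eval (fun s => π.πb (C.qb s)) (fun s => (π.πb_mem _).2) (ρb (C.qb z.1))
    (fun b => C.stateLaw z.1 * outGiven (π.πa (C.qa z.1)) (C.chan z.1) b z.2), hρb,
    Finset.mul_sum]
  exact Finset.sum_congr rfl fun a _ => by ring

theorem divFirst_strategyChannel (hρa : ∀ s, C.qa (ρa (C.qa s)) = C.qa s)
    (hρb : ∀ s, C.qb (ρb (C.qb s)) = C.qb s) :
    divFirst (fun u : S → Xa => ∏ s, π.πa (C.qa s) (u s))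
        (fun v : S → Xb => ∏ s, π.πb (C.qb s) (v s)) (C.strategyChannel ρa ρb) =
      C.infoA π * Real.log 2 := by
  rw [infoA_mul_log_two]
  unfold divFirst
  rw [← C.meanLogRatio_strategyChannel π hρa hρb
    (fun s _ b y => outGiven (π.πa (C.qa s)) (C.chan s) b y)]
  simp only [C.outGiven_strategyChannel π hρa]

theorem divSecond_strategyChannel (hρa : ∀ s, C.qa (ρa (C.qa s)) = C.qa s)
    (hρb : ∀ s, C.qb (ρb (C.qb s)) = C.qb s) :
    divSecond (fun u : S → Xa => ∏ s, π.πa (C.qa s) (u s))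
        (fun v : S → Xb => ∏ s, π.πb (C.qb s) (v s)) (C.strategyChannel ρa ρb) =
      C.infoB π * Real.log 2 := by
  rw [infoB_mul_log_two]
  unfold divSecond
  rw [← C.meanLogRatio_strategyChannel π hρa hρb
    (fun s a _ y => outGiven (π.πb (C.qb s)) (fun b a => C.chan s a b) a y)]
  simp only [C.outGiven_strategyChannel_swap π hρb]

theorem divBoth_strategyChannel (hρa : ∀ s, C.qa (ρa (C.qa s)) = C.qa s)
    (hρb : ∀ s, C.qb (ρb (C.qb s)) = C.qb s) :
    divBoth (fun u : S → Xa => ∏ s, π.πa (C.qa s) (u s))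
        (fun v : S → Xb => ∏ s, π.πb (C.qb s) (v s)) (C.strategyChannel ρa ρb) =
      C.infoSum π * Real.log 2 := by
  rw [infoSum_mul_log_two]
  unfold divBoth
  rw [← C.meanLogRatio_strategyChannel π hρa hρb
    (fun s _ _ y => outBoth (π.πa (C.qa s)) (π.πb (C.qb s)) (C.chan s) y)]
  simp only [C.outBoth_strategyChannel π hρa hρb]

end FSMAC

/-! ### Achievability -/

open Filter Topology

theorem natCeil_two_rpow_pos (x : ℝ) : 0 < ⌈(2 : ℝ) ^ x⌉₊ :=
  Nat.ceil_pos.2 (Real.rpow_pos_of_pos two_pos x)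

theorem natCeil_two_rpow_sub_one_nonneg (x : ℝ) : 0 ≤ (⌈(2 : ℝ) ^ x⌉₊ : ℝ) - 1 :=
  sub_nonneg.2 (by exact_mod_cast natCeil_two_rpow_pos x)

theorem natCeil_two_rpow_sub_one_le (x : ℝ) :
    (⌈(2 : ℝ) ^ x⌉₊ : ℝ) - 1 ≤ Real.exp (x * Real.log 2) := by
  have h := Nat.ceil_lt_add_one (Real.rpow_pos_of_pos (two_pos (α := ℝ)) x).le
  rw [mul_comm, ← Real.rpow_def_of_pos two_pos]
  linarith

theorem tendsto_exp_neg_nat_mul {c : ℝ} (hc : 0 < c) :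
    Tendsto (fun n : ℕ => Real.exp (-(n * c))) atTop (𝓝 0) :=
  Real.tendsto_exp_neg_atTop_nhds_zero.comp
    (tendsto_natCast_atTop_atTop.atTop_mul_const hc)

/-- A message set of rate `R` below the exponent `γ`, or with a single message, makes the union
bound vanish. -/
theorem tendsto_wrong_messages {R γ : ℝ} (h : R = 0 ∨ R * Real.log 2 < γ) :
    Tendsto (fun n : ℕ => ((⌈(2 : ℝ) ^ (R * (n : ℝ))⌉₊ : ℝ) - 1) * Real.exp (-(n * γ)))
      atTop (𝓝 0) := by
  rcases h with rfl | h
  · simp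
  refine squeeze_zero
    (fun n => mul_nonneg (natCeil_two_rpow_sub_one_nonneg _) (Real.exp_pos _).le) (fun n => ?_)
    (tendsto_exp_neg_nat_mul (sub_pos.2 h))
  refine (mul_le_mul_of_nonneg_right (natCeil_two_rpow_sub_one_le _)
    (Real.exp_pos _).le).trans (le_of_eq ?_)
  rw [← Real.exp_add]
  congr 1
  ring

theorem tendsto_wrong_message_pairs {R R' γ : ℝ}
    (h : R = 0 ∨ R' = 0 ∨ (R + R') * Real.log 2 < γ) :
    Tendsto (fun n : ℕ => ((⌈(2 : ℝ) ^ (R * (n : ℝ))⌉₊ : ℝ) - 1) *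
      ((⌈(2 : ℝ) ^ (R' * (n : ℝ))⌉₊ : ℝ) - 1) * Real.exp (-(n * γ))) atTop (𝓝 0) := by
  rcases h with rfl | rfl | h
  · simp
  · simp
  refine squeeze_zero
    (fun n => mul_nonneg (mul_nonneg (natCeil_two_rpow_sub_one_nonneg _)
      (natCeil_two_rpow_sub_one_nonneg _)) (Real.exp_pos _).le) (fun n => ?_)
    (tendsto_exp_neg_nat_mul (sub_pos.2 h))
  refine (mul_le_mul_of_nonneg_right (mul_le_mul (natCeil_two_rpow_sub_one_le _)
    (natCeil_two_rpow_sub_one_le _) (natCeil_two_rpow_sub_one_nonneg _) (Real.exp_pos _).le)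
    (Real.exp_pos _).le).trans (le_of_eq ?_)
  rw [← Real.exp_add, ← Real.exp_add]
  congr 1
  ring

namespace FSMAC

variable {S Va Vb Xa Xb Y : Type*} [Fintype S] [Fintype Y]
  (C : FSMAC S Va Vb Xa Xb Y)

theorem errorProb_strategyCode (ρa : Va → S) (ρb : Vb → S) {n Ma Mb : ℕ}
    (x : Fin Ma → Fin n → S → Xa) (x' : Fin Mb → Fin n → S → Xb)
    (dec : (Fin n → S × Y) → Fin Ma × Fin Mb) :
    C.errorProb (strategyCode ρa ρb x x' dec) =
      ∑ w : Fin Ma × Fin Mb, 1 / (Ma : ℝ) * (1 / (Mb : ℝ)) * ∑ z : Fin n → S × Y,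
        if dec z ≠ w then ∏ t, C.strategyChannel ρa ρb (x w.1 t) (x' w.2 t) (z t) else 0 := by
  unfold errorProb
  refine Finset.sum_congr rfl fun w _ => ?_
  rw [sum_pi_prod_type]
  simp only [Finset.mul_sum]
  refine Finset.sum_congr rfl fun s _ => Finset.sum_congr rfl fun y _ => ?_
  rw [mul_ite, mul_zero]
  refine if_congr Iff.rfl ?_ rfl
  simp only [jointLaw, strategyChannel, Finset.prod_mul_distrib, mul_assoc]
  rfl

variable [Fintype Xa] [Fintype Xb]

/-- Rates below the time-shared informations are achievable. A rate that vanishes asks for a single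
message, so the constraints in which it takes part can be dropped. -/
theorem achievable_of_lt_mixture {Q : Type*} [Fintype Q] {lam : Q → ℝ}
    (hlam : lam ∈ stdSimplex ℝ Q) (π : Q → TeamPolicy Va Vb Xa Xb) {R : ℝ × ℝ} (h1 : 0 ≤ R.1)
    (h2 : 0 ≤ R.2) (ha : R.1 = 0 ∨ R.1 < ∑ q, lam q * C.infoA (π q))
    (hb : R.2 = 0 ∨ R.2 < ∑ q, lam q * C.infoB (π q))
    (hs : R.1 = 0 ∨ R.2 = 0 ∨ R.1 + R.2 < ∑ q, lam q * C.infoSum (π q)) :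
    C.Achievable R := by
  classical
  refine ⟨h1, h2, fun ε hε => ?_⟩
  have hlog : 0 < Real.log 2 := Real.log_pos one_lt_two
  have hS : Nonempty S := by
    by_contra hS
    rw [not_nonempty_iff] at hS
    simpa using C.stateLaw_mem.2
  have hρa : ∀ s, C.qa (Function.invFun C.qa (C.qa s)) = C.qa s :=
    fun s => Function.invFun_eq ⟨s, rfl⟩
  have hρb : ∀ s, C.qb (Function.invFun C.qb (C.qb s)) = C.qb s :=
    fun s => Function.invFun_eq ⟨s, rfl⟩
  -- Every constraint leaves room for a threshold rate strictly below the information.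
  have hthr : ∀ I T : ℝ, ∀ P : Prop, (P ∨ T < I) →
      ∃ γ, γ < I * Real.log 2 ∧ (P ∨ T * Real.log 2 < γ) := by
    rintro I T P (hP | hT)
    · exact ⟨I * Real.log 2 - 1, by linarith, Or.inl hP⟩
    · obtain ⟨γ, h1, h2⟩ := exists_between (mul_lt_mul_of_pos_right hT hlog)
      exact ⟨γ, h2, Or.inr h1⟩
  obtain ⟨γa, hγa, hRa⟩ := hthr _ _ _ ha
  obtain ⟨γb, hγb, hRb⟩ := hthr _ _ _ hb
  obtain ⟨γs, hγs, hRs⟩ := hthr _ _ _ (or_assoc.2 hs)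
  rw [Finset.sum_mul] at hγa hγb hγs
  simp only [mul_assoc] at hγa hγb hγs
  have hp := fun q => prod_pi_mem_stdSimplex fun s => (π q).πa_mem (C.qa s)
  have hr := fun q => prod_pi_mem_stdSimplex fun s => (π q).πb_mem (C.qb s)
  have hW := C.strategyChannel_mem (Xa := Xa) (Xb := Xb) (Function.invFun C.qa)
    (Function.invFun C.qb)
  obtain ⟨K, hK⟩ := exists_timeSharing_testFailure_le hlam hp hr hW
    (by simpa only [C.divFirst_strategyChannel _ hρa hρb] using hγa)
    (by simpa only [C.divSecond_strategyChannel _ hρa hρb] using hγb)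
    (by simpa only [C.divBoth_strategyChannel _ hρa hρb] using hγs)
  have hlim : Tendsto (fun n : ℕ => K / n +
      ((⌈(2 : ℝ) ^ (R.1 * (n : ℝ))⌉₊ : ℝ) - 1) * Real.exp (-(n * γa)) +
      ((⌈(2 : ℝ) ^ (R.2 * (n : ℝ))⌉₊ : ℝ) - 1) * Real.exp (-(n * γb)) +
      ((⌈(2 : ℝ) ^ (R.1 * (n : ℝ))⌉₊ : ℝ) - 1) * ((⌈(2 : ℝ) ^ (R.2 * (n : ℝ))⌉₊ : ℝ) - 1) *
        Real.exp (-(n * γs))) atTop (𝓝 0) := by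
    have := (((tendsto_const_div_atTop_nhds_zero_nat K).add (tendsto_wrong_messages hRa)).add
      (tendsto_wrong_messages hRb)).add (tendsto_wrong_message_pairs (or_assoc.1 hRs))
    simpa using this
  obtain ⟨n, hn, hn1⟩ := ((hlim.eventually (gt_mem_nhds hε)).and (eventually_ge_atTop 1)).exists
  obtain ⟨q, hq⟩ := hK n hn1
  obtain ⟨x, x', dec, hcode⟩ := exists_code_of_thresholds
    (prod_pi_mem_stdSimplex fun t : Fin n => hp (q t))
    (prod_pi_mem_stdSimplex fun t : Fin n => hr (q t))
    (fun u v => prod_pi_mem_stdSimplex fun t : Fin n => hW (u t) (v t))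
    (n * γa) (n * γb) (n * γs) (natCeil_two_rpow_pos (R.1 * n)) (natCeil_two_rpow_pos (R.2 * n))
  refine ⟨n, hn1, _, _, strategyCode (Function.invFun C.qa) (Function.invFun C.qb) x x' dec,
    Nat.le_ceil _, Nat.le_ceil _, ?_⟩
  rw [errorProb_strategyCode]
  refine hcode.trans (le_trans ?_ hn.le)
  gcongr

end FSMAC

/-! ### Converse -/

/-- The Fano correction in nats, an upper bound for the binary entropy of error probabilities up to
`ε`. -/
noncomputable def fanoSlack (ε : ℝ) : ℝ :=
  -Real.log (1 - ε) - ε * Real.log ε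

theorem fanoSlack_nonneg {ε : ℝ} (h0 : 0 < ε) (h1 : ε < 1) : 0 ≤ fanoSlack ε := by
  have l1 := Real.log_nonpos (sub_nonneg.2 h1.le) (by linarith)
  have l2 := mul_nonneg h0.le (neg_nonneg.2 (Real.log_nonpos h0.le h1.le))
  unfold fanoSlack
  linarith

theorem tendsto_fanoSlack : Tendsto fanoSlack (𝓝[>] 0) (𝓝 0) := by
  have h1 : Tendsto (fun ε : ℝ => -Real.log (1 - ε)) (𝓝[>] 0) (𝓝 0) := by
    have : ContinuousAt (fun ε : ℝ => -Real.log (1 - ε)) 0 := by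
      refine ContinuousAt.neg (ContinuousAt.log (by fun_prop) (by norm_num))
    have h := this.tendsto
    simp only [sub_zero, Real.log_one, neg_zero] at h
    exact h.mono_left nhdsWithin_le_nhds
  have h2 : Tendsto (fun ε : ℝ => ε * Real.log ε) (𝓝[>] 0) (𝓝 0) := by
    have h := Real.continuous_mul_log.tendsto 0
    simp only [zero_mul] at h
    exact h.mono_left nhdsWithin_le_nhds
  have h := h1.sub h2
  rw [sub_zero] at h
  exact h

/-- A form of Fano's inequality: if the event `E` has probability at least `1 - ε` under `p` and at
most `1 / M` under the reference `q`, then the divergence of `p` from `q` is almost `log M`. -/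
theorem fano_of_reference {Ω : Type*} [Fintype Ω] {p q : Ω → ℝ} (hp : p ∈ stdSimplex ℝ Ω)
    (hq : ∀ ω, 0 ≤ q ω) (hpq : ∀ ω, q ω = 0 → p ω = 0) (hq1 : ∑ ω, q ω ≤ 1) (E : Ω → Prop)
    [DecidablePred E] {M ε : ℝ} (hM : 1 ≤ M) (hε0 : 0 < ε) (hε1 : ε < 1)
    (hqE : ∑ ω, (if E ω then q ω else 0) ≤ 1 / M) (hpE : ∑ ω, (if E ω then 0 else p ω) ≤ ε) :
    (1 - ε) * Real.log M ≤ ∑ ω, p ω * Real.log (p ω / q ω) + fanoSlack ε := by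
  have hM0 : 0 < M := by linarith
  have hε' : 0 < 1 - ε := by linarith
  -- Tilting the reference by `(1 - ε) M` on `E` and by `ε` off `E` keeps its mass at most one.
  set c : Ω → ℝ := fun ω => if E ω then (1 - ε) * M else ε with hc
  have hc0 : ∀ ω, 0 < c ω := fun ω => by
    simp only [hc]
    split_ifs <;> positivity
  have hmass : ∑ ω, q ω * c ω ≤ 1 := by
    have h1 : ∀ ω, q ω * c ω ≤ (1 - ε) * M * (if E ω then q ω else 0) + ε * q ω := fun ω => by
      simp only [hc]
      split_ifs
      · nlinarith [hq ω, mul_nonneg hε0.le (hq ω)]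
      · linarith
    refine (Finset.sum_le_sum fun ω _ => h1 ω).trans ?_
    rw [Finset.sum_add_distrib, ← Finset.mul_sum, ← Finset.mul_sum]
    have h2 := mul_le_mul_of_nonneg_left hqE (mul_pos hε' hM0).le
    have h3 : (1 - ε) * M * (1 / M) = 1 - ε := by field_simp
    have h4 := mul_le_mul_of_nonneg_left hq1 hε0.le
    linarith
  have key := sum_mul_log_div_le p (fun ω => q ω * c ω) hp.1
    (fun ω => mul_nonneg (hq ω) (hc0 ω).le)
    (fun ω h => hpq ω ((mul_eq_zero.1 h).resolve_right (hc0 ω).ne'))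
  rw [hp.2] at key
  set e := ∑ ω, (if E ω then 0 else p ω) with he
  have he0 : 0 ≤ e := Finset.sum_nonneg fun ω _ => by
    split_ifs
    · exact le_rfl
    · exact hp.1 ω
  have hlogc : ∑ ω, p ω * Real.log (c ω) =
      (1 - e) * (Real.log (1 - ε) + Real.log M) + e * Real.log ε := by
    have h1 : ∀ ω, p ω * Real.log (c ω) = (p ω - if E ω then 0 else p ω) *
        (Real.log (1 - ε) + Real.log M) + (if E ω then 0 else p ω) * Real.log ε := fun ω => by
      simp only [hc]
      split_ifs
      · rw [Real.log_mul hε'.ne' hM0.ne']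
        ring
      · ring
    simp only [h1]
    rw [Finset.sum_add_distrib, ← Finset.sum_mul, ← Finset.sum_mul, Finset.sum_sub_distrib, hp.2]
  have hsplit : ∑ ω, p ω * Real.log (q ω * c ω / p ω) =
      ∑ ω, p ω * Real.log (c ω) - ∑ ω, p ω * Real.log (p ω / q ω) := by
    rw [← Finset.sum_sub_distrib]
    refine Finset.sum_congr rfl fun ω _ => ?_
    by_cases h : p ω = 0
    · simp [h]
    · have hqω : q ω ≠ 0 := fun h0 => h (hpq ω h0)
      rw [Real.log_div (mul_ne_zero hqω (hc0 ω).ne') h, Real.log_mul hqω (hc0 ω).ne',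
        Real.log_div h hqω]
      ring
  rw [hsplit, hlogc] at key
  have l1 : Real.log (1 - ε) ≤ 0 := Real.log_nonpos hε'.le (by linarith)
  have l2 : Real.log ε ≤ 0 := Real.log_nonpos hε0.le hε1.le
  have l3 : 0 ≤ Real.log M := Real.log_nonneg hM
  unfold fanoSlack
  nlinarith [mul_nonneg (sub_nonneg.2 hpE) l3, mul_nonneg he0 (neg_nonneg.2 l1),
    mul_nonneg (sub_nonneg.2 hpE) (neg_nonneg.2 l2)]

section Empirical

variable {X X' Y : Type*}

open Classical in
/-- The law of `φ w` for a uniformly distributed message `w`. -/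
noncomputable def uniformPush {M : ℕ} (φ : Fin M → X) (x : X) : ℝ :=
  ∑ w, 1 / (M : ℝ) * if φ w = x then 1 else 0

theorem uniformPush_apply_ne_zero {M : ℕ} (φ : Fin M → X) (w : Fin M) :
    uniformPush φ (φ w) ≠ 0 := by
  have hM : 0 < (M : ℝ) := by exact_mod_cast (Nat.zero_le _).trans_lt w.2
  refine (Finset.sum_pos' (fun v _ => mul_nonneg (by positivity) ?_)
    ⟨w, Finset.mem_univ w, ?_⟩).ne'
  · split_ifs <;> norm_num
  · simpa using hM

variable [Fintype X]

theorem sum_uniformPush_mul {M : ℕ} (φ : Fin M → X) (F : X → ℝ) :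
    ∑ x, uniformPush φ x * F x = 1 / (M : ℝ) * ∑ w, F (φ w) := by
  classical
  unfold uniformPush
  simp only [Finset.sum_mul, Finset.mul_sum]
  rw [Finset.sum_comm]
  refine Finset.sum_congr rfl fun w _ => ?_
  simp

theorem uniformPush_mem {M : ℕ} (hM : 0 < M) (φ : Fin M → X) :
    uniformPush φ ∈ stdSimplex ℝ X := by
  refine ⟨fun x => Finset.sum_nonneg fun w _ => mul_nonneg (by positivity) ?_, ?_⟩
  · split_ifs <;> norm_num
  · have h := sum_uniformPush_mul φ fun _ => 1
    simp only [mul_one, Finset.sum_const, Finset.card_univ, Fintype.card_fin, nsmul_eq_mul] at h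
    rw [h, one_div_mul_cancel]
    exact_mod_cast hM.ne'

variable [Fintype X'] [Fintype Y]

theorem meanLogRatio_uniformPush {Ma Mb : ℕ} (φ : Fin Ma → X) (φ' : Fin Mb → X')
    (K q : X → X' → Y → ℝ) :
    meanLogRatio (uniformPush φ) (uniformPush φ') K q =
      1 / (Ma : ℝ) * (1 / (Mb : ℝ)) * ∑ w : Fin Ma × Fin Mb, ∑ y, K (φ w.1) (φ' w.2) y *
        Real.log (K (φ w.1) (φ' w.2) y / q (φ w.1) (φ' w.2) y) := by
  unfold meanLogRatio
  simp only [mul_assoc, ← Finset.mul_sum]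
  rw [sum_uniformPush_mul φ fun a => ∑ b, uniformPush φ' b *
    ∑ y, K a b y * Real.log (K a b y / q a b y)]
  simp only [fun a => sum_uniformPush_mul φ' fun b =>
    ∑ y, K a b y * Real.log (K a b y / q a b y)]
  rw [Fintype.sum_prod_type, ← Finset.mul_sum]

end Empirical

open Classical in
theorem observed_update {S V : Type*} {n : ℕ} (f : S → V) (t : Fin n) (s : Fin n → S) (a : S) :
    (fun j : Fin (t + 1) => f (Function.update s t a (Fin.castLE t.isLt j))) =
      Function.update (fun j => f (s (Fin.castLE t.isLt j))) (Fin.last t) (f a) := by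
  funext j
  by_cases h : j = Fin.last t
  · subst h
    have : Fin.castLE t.isLt (Fin.last (t : ℕ)) = t := Fin.ext rfl
    rw [this, Function.update_self, Function.update_self]
  · have : Fin.castLE t.isLt j ≠ t := fun he => h (by simpa [Fin.ext_iff] using he)
    rw [Function.update_of_ne this, Function.update_of_ne h]

namespace FSMAC

variable {S Va Vb Xa Xb Y : Type*} [Fintype S] [Fintype Y]
  (C : FSMAC S Va Vb Xa Xb Y) {n Ma Mb : ℕ} (c : BlockCode S Va Vb Xa Xb Y n Ma Mb)

/-- Fano's inequality for a block code against a reference under which the outputs are independent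
given the states and a label `κ w` of the messages. The decoder finds a message pair from the label
with probability at most `1 / M` under the reference, where `M` is the mean number of message
pairs per label. -/
theorem fano_blockCode (hMa : 0 < Ma) (hMb : 0 < Mb) {L : Type*} [Fintype L]
    (κ : Fin Ma × Fin Mb → L) (q : L → (Fin n → S) → Fin n → Y → ℝ)
    (hq : ∀ l s t, q l s t ∈ stdSimplex ℝ Y)
    (hsupp : ∀ w s t y, C.chan (s t) (C.inputA c w.1 s t) (C.inputB c w.2 s t) y ≠ 0 →
      q (κ w) s t y ≠ 0)
    {M ε : ℝ} (hM : 1 ≤ M) (hML : (Ma : ℝ) * Mb = M * Fintype.card L) (hε0 : 0 < ε)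
    (hε1 : ε < 1) (herr : C.errorProb c ≤ ε) :
    (1 - ε) * Real.log M ≤ ∑ t, ∑ s : Fin n → S, (∏ i, C.stateLaw (s i)) *
      (1 / (Ma : ℝ) * (1 / (Mb : ℝ)) * ∑ w : Fin Ma × Fin Mb, ∑ y,
        C.chan (s t) (C.inputA c w.1 s t) (C.inputB c w.2 s t) y *
        Real.log (C.chan (s t) (C.inputA c w.1 s t) (C.inputB c w.2 s t) y / q (κ w) s t y)) +
      fanoSlack ε := by
  classical
  have hMa' : (0 : ℝ) < Ma := by exact_mod_cast hMa
  have hMb' : (0 : ℝ) < Mb := by exact_mod_cast hMb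
  set u : ℝ := 1 / (Ma : ℝ) * (1 / (Mb : ℝ)) with hu
  have hu0 : 0 < u := by positivity
  set K : Fin Ma × Fin Mb → (Fin n → S) → Fin n → Y → ℝ := fun w s t =>
    C.chan (s t) (C.inputA c w.1 s t) (C.inputB c w.2 s t) with hK
  have hKmem : ∀ w s t, K w s t ∈ stdSimplex ℝ Y := fun w s t => C.chan_mem _ _ _
  have hP0 : ∀ s : Fin n → S, 0 ≤ ∏ i, C.stateLaw (s i) := fun s =>
    Finset.prod_nonneg fun i _ => C.stateLaw_mem.1 _
  have hP1 : ∑ s : Fin n → S, ∏ i, C.stateLaw (s i) = 1 :=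
    sum_pi_prod (fun _ : Fin n => C.stateLaw) fun _ => C.stateLaw_mem.2
  have hK1 : ∀ w s, ∑ y : Fin n → Y, ∏ t, K w s t (y t) = 1 := fun w s =>
    sum_pi_prod (K w s) fun t => (hKmem w s t).2
  have hq1 : ∀ l s, ∑ y : Fin n → Y, ∏ t, q l s t (y t) = 1 := fun l s =>
    sum_pi_prod (q l s) fun t => (hq l s t).2
  have hcard : ((Finset.univ : Finset (Fin Ma × Fin Mb)).card : ℝ) * u = 1 := by
    rw [Finset.card_univ, Fintype.card_prod, Fintype.card_fin, Fintype.card_fin, hu]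
    push_cast
    field_simp
  have hJ : ∀ w s y, C.jointLaw c w s y = u * (∏ i, C.stateLaw (s i)) * ∏ t, K w s t (y t) :=
    fun _ _ _ => rfl
  have key := fano_of_reference
    (p := fun ω : (Fin Ma × Fin Mb) × (Fin n → S) × (Fin n → Y) =>
      C.jointLaw c ω.1 ω.2.1 ω.2.2)
    (q := fun ω => u * (∏ i, C.stateLaw (ω.2.1 i)) * ∏ t, q (κ ω.1) ω.2.1 t (ω.2.2 t))
    ?_ ?_ ?_ ?_ (fun ω => c.dec ω.2.1 ω.2.2 = ω.1) hM hε0 hε1 ?_ ?_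
  · refine key.trans (add_le_add_left (le_of_eq ?_) _)
    simp only [Fintype.sum_prod_type (α₁ := Fin Ma × Fin Mb), Fintype.sum_prod_type
      (α₁ := Fin n → S)]
    have hlog : ∀ w s (y : Fin n → Y), C.jointLaw c w s y * Real.log (C.jointLaw c w s y /
        (u * (∏ i, C.stateLaw (s i)) * ∏ t, q (κ w) s t (y t))) =
        ∑ t, u * (∏ i, C.stateLaw (s i)) * ((∏ t, K w s t (y t)) *
          Real.log (K w s t (y t) / q (κ w) s t (y t))) := by
      intro w s y
      rw [hJ]
      by_cases h : u * (∏ i, C.stateLaw (s i)) * ∏ t, K w s t (y t) = 0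
      · rw [h, zero_mul]
        refine (Finset.sum_eq_zero fun t _ => ?_).symm
        rw [← mul_assoc, h, zero_mul]
      · have h1 := left_ne_zero_of_mul h
        have h2 : ∀ t, K w s t (y t) ≠ 0 := fun t =>
          Finset.prod_ne_zero_iff.1 (right_ne_zero_of_mul h) t (Finset.mem_univ t)
        rw [mul_div_mul_left _ _ h1, ← Finset.prod_div_distrib,
          Real.log_prod (fun t _ => div_ne_zero (h2 t) (hsupp w s t (y t) (h2 t)))]
        simp only [Finset.mul_sum, mul_assoc]
    simp only [hlog]
    have hmarg : ∀ w s t, ∑ y : Fin n → Y, u * (∏ i, C.stateLaw (s i)) *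
        ((∏ t, K w s t (y t)) * Real.log (K w s t (y t) / q (κ w) s t (y t))) =
        u * (∏ i, C.stateLaw (s i)) *
          ∑ y, K w s t y * Real.log (K w s t y / q (κ w) s t y) := by
      intro w s t
      rw [← Finset.mul_sum, sum_pi_eval (K w s) (fun t => (hKmem w s t).2) t
        (fun y => Real.log (K w s t y / q (κ w) s t y))]
    calc _ = ∑ w, ∑ s, ∑ t, u * (∏ i, C.stateLaw (s i)) *
          ∑ y, K w s t y * Real.log (K w s t y / q (κ w) s t y) := by
          refine Finset.sum_congr rfl fun w _ => Finset.sum_congr rfl fun s _ => ?_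
          rw [Finset.sum_comm]
          exact Finset.sum_congr rfl fun t _ => hmarg w s t
      _ = ∑ t, ∑ s, ∑ w, u * (∏ i, C.stateLaw (s i)) *
          ∑ y, K w s t y * Real.log (K w s t y / q (κ w) s t y) := by
          rw [Finset.sum_congr rfl fun w _ => Finset.sum_comm, Finset.sum_comm]
          exact Finset.sum_congr rfl fun t _ => Finset.sum_comm
      _ = _ := by
          refine Finset.sum_congr rfl fun t _ => Finset.sum_congr rfl fun s _ => ?_
          rw [← Finset.mul_sum]
          ring
  · refine ⟨fun ω => ?_, ?_⟩
    · simp only [hJ]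
      exact mul_nonneg (mul_nonneg hu0.le (hP0 _))
        (Finset.prod_nonneg fun t _ => (hKmem _ _ t).1 _)
    · simp only [Fintype.sum_prod_type (α₁ := Fin Ma × Fin Mb), Fintype.sum_prod_type
        (α₁ := Fin n → S), hJ, ← Finset.mul_sum, hK1, mul_one, hP1, Finset.sum_const,
        nsmul_eq_mul]
      exact hcard
  · exact fun ω => mul_nonneg (mul_nonneg hu0.le (hP0 _))
      (Finset.prod_nonneg fun t _ => (hq _ _ t).1 _)
  · intro ω h
    by_contra hne
    simp only [hJ] at hne
    refine mul_ne_zero (left_ne_zero_of_mul hne) (Finset.prod_ne_zero_iff.2 fun t _ => ?_) h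
    exact hsupp _ _ _ _
      (Finset.prod_ne_zero_iff.1 (right_ne_zero_of_mul hne) t (Finset.mem_univ t))
  · refine le_of_eq ?_
    simp only [Fintype.sum_prod_type (α₁ := Fin Ma × Fin Mb), Fintype.sum_prod_type
      (α₁ := Fin n → S), ← Finset.mul_sum, hq1, mul_one, hP1, Finset.sum_const, nsmul_eq_mul]
    exact hcard
  · simp only [Fintype.sum_prod_type (α₁ := Fin Ma × Fin Mb), Fintype.sum_prod_type
      (α₁ := Fin n → S)]
    rw [Finset.sum_comm, Finset.sum_congr rfl fun s _ => Finset.sum_comm]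
    simp only [Finset.sum_ite_eq, Finset.mem_univ, if_true]
    calc ∑ s : Fin n → S, ∑ y : Fin n → Y, u * (∏ i, C.stateLaw (s i)) *
          ∏ t, q (κ (c.dec s y)) s t (y t)
        ≤ ∑ s : Fin n → S, ∑ y : Fin n → Y, ∑ l, u * (∏ i, C.stateLaw (s i)) *
          ∏ t, q l s t (y t) := by
          refine Finset.sum_le_sum fun s _ => Finset.sum_le_sum fun y _ => ?_
          exact Finset.single_le_sum (f := fun l => u * (∏ i, C.stateLaw (s i)) *
            ∏ t, q l s t (y t)) (fun l _ => mul_nonneg (mul_nonneg hu0.le (hP0 _))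
            (Finset.prod_nonneg fun t _ => (hq _ _ t).1 _)) (Finset.mem_univ _)
      _ = u * Fintype.card L := by
          rw [Finset.sum_congr rfl fun s _ => Finset.sum_comm, Finset.sum_comm]
          simp only [← Finset.mul_sum, hq1, mul_one, hP1, Finset.sum_const, Finset.card_univ,
            nsmul_eq_mul]
          ring
      _ = 1 / M := by
          have hM0 : M ≠ 0 := by linarith
          rw [hu, one_div_mul_one_div, hML]
          have hL : (Fintype.card L : ℝ) ≠ 0 := fun h => by
            rw [h, mul_zero] at hML
            exact (mul_pos hMa' hMb').ne' hML
          field_simp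
  · refine le_trans (le_of_eq ?_) herr
    unfold errorProb
    simp only [Fintype.sum_prod_type (α₁ := Fin Ma × Fin Mb), Fintype.sum_prod_type
      (α₁ := Fin n → S), ne_eq, ite_not]

variable [Fintype Xa] [Fintype Xb]

open Classical in
/-- The team policy that a block code follows at time `t` when the states before `t` are those of
`s`: the randomness of the inputs comes from the uniform messages, and the current observation
takes the place of the last entry of the observed sequence. -/
noncomputable def inducedPolicy (hMa : 0 < Ma) (hMb : 0 < Mb) (t : Fin n) (s : Fin n → S) :
    TeamPolicy Va Vb Xa Xb where
  πa v := uniformPush fun w => c.encA t w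
    (Function.update (fun j => C.qa (s (Fin.castLE t.isLt j))) (Fin.last t) v)
  πa_mem _ := uniformPush_mem hMa _
  πb v := uniformPush fun w => c.encB t w
    (Function.update (fun j => C.qb (s (Fin.castLE t.isLt j))) (Fin.last t) v)
  πb_mem _ := uniformPush_mem hMb _

/-- Averaging a functional of the state at time `t` and of the induced input laws over all state
sequences is averaging its mean under the induced team policies: redraw the state at time `t`. -/
theorem sum_states_eq_sum_inducedPolicy (hMa : 0 < Ma) (hMb : 0 < Mb) (t : Fin n)
    (F : S → (Xa → ℝ) → (Xb → ℝ) → ℝ) :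
    ∑ s : Fin n → S, (∏ i, C.stateLaw (s i)) * F (s t) (uniformPush fun w => C.inputA c w s t)
        (uniformPush fun w => C.inputB c w s t) =
      ∑ s : Fin n → S, (∏ i, C.stateLaw (s i)) * ∑ a, C.stateLaw a *
        F a ((C.inducedPolicy c hMa hMb t s).πa (C.qa a))
          ((C.inducedPolicy c hMa hMb t s).πb (C.qb a)) := by
  classical
  rw [sum_pi_resample (fun _ : Fin n => C.stateLaw) t C.stateLaw_mem.2]
  refine Finset.sum_congr rfl fun s _ => ?_
  congr 1
  refine Finset.sum_congr rfl fun a _ => ?_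
  simp only [Function.update_self, inputA, inputB, observed_update, inducedPolicy]

/-- The single-letter converse: a code with small error probability has rates below the informations
averaged over the policies that it induces at each time and for each past. -/
theorem exists_mixture_of_hasCodingScheme {R : ℝ × ℝ} (hn : 1 ≤ n) {ε : ℝ} (hε0 : 0 < ε)
    (hε1 : ε < 1) (h : C.HasCodingScheme R n ε) :
    ∃ μ ∈ stdSimplex ℝ (Fin n × (Fin n → S)), ∃ π : Fin n × (Fin n → S) → TeamPolicy Va Vb Xa Xb,
      (1 - ε) * R.1 ≤ ∑ i, μ i * C.infoA (π i) + fanoSlack ε / Real.log 2 ∧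
      (1 - ε) * R.2 ≤ ∑ i, μ i * C.infoB (π i) + fanoSlack ε / Real.log 2 ∧
      (1 - ε) * (R.1 + R.2) ≤ ∑ i, μ i * C.infoSum (π i) + fanoSlack ε / Real.log 2 := by
  classical
  obtain ⟨Ma, Mb, c, hRa, hRb, herr⟩ := h
  have hMa' : (0 : ℝ) < Ma := (Real.rpow_pos_of_pos two_pos _).trans_le hRa
  have hMb' : (0 : ℝ) < Mb := (Real.rpow_pos_of_pos two_pos _).trans_le hRb
  have hMa : 0 < Ma := by exact_mod_cast hMa'
  have hMb : 0 < Mb := by exact_mod_cast hMb'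
  have hMa1 : (1 : ℝ) ≤ Ma := by exact_mod_cast hMa
  have hMb1 : (1 : ℝ) ≤ Mb := by exact_mod_cast hMb
  have hn0 : (0 : ℝ) < n := by exact_mod_cast hn
  have hn1 : (1 : ℝ) ≤ n := by exact_mod_cast hn
  have hlog : 0 < Real.log 2 := Real.log_pos one_lt_two
  have hla : R.1 * n * Real.log 2 ≤ Real.log Ma := by
    rw [← Real.log_rpow two_pos]
    exact Real.log_le_log (Real.rpow_pos_of_pos two_pos _) hRa
  have hlb : R.2 * n * Real.log 2 ≤ Real.log Mb := by
    rw [← Real.log_rpow two_pos]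
    exact Real.log_le_log (Real.rpow_pos_of_pos two_pos _) hRb
  have hP1 : ∑ s : Fin n → S, ∏ i, C.stateLaw (s i) = 1 :=
    sum_pi_prod (fun _ : Fin n => C.stateLaw) fun _ => C.stateLaw_mem.2
  have hA := fun s t => uniformPush_mem hMa fun w => C.inputA c w s t
  have hB := fun s t => uniformPush_mem hMb fun w => C.inputB c w s t
  -- Dividing a bound for the block by `n log 2`.
  have hdiv : ∀ (T LM : ℝ) (I : TeamPolicy Va Vb Xa Xb → ℝ), T * n * Real.log 2 ≤ LM →
      (1 - ε) * LM ≤ ∑ t, ∑ s : Fin n → S, (∏ i, C.stateLaw (s i)) *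
        (I (C.inducedPolicy c hMa hMb t s) * Real.log 2) + fanoSlack ε →
      (1 - ε) * T ≤ ∑ i : Fin n × (Fin n → S), 1 / (n : ℝ) * (∏ j, C.stateLaw (i.2 j)) *
        I (C.inducedPolicy c hMa hMb i.1 i.2) + fanoSlack ε / Real.log 2 := by
    intro T LM I hT hLM
    have h1 : ∑ i : Fin n × (Fin n → S), 1 / (n : ℝ) * (∏ j, C.stateLaw (i.2 j)) *
        I (C.inducedPolicy c hMa hMb i.1 i.2) = (∑ t, ∑ s : Fin n → S,
        (∏ i, C.stateLaw (s i)) * (I (C.inducedPolicy c hMa hMb t s) * Real.log 2)) /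
        (n * Real.log 2) := by
      rw [Fintype.sum_prod_type, Finset.sum_div]
      refine Finset.sum_congr rfl fun t _ => ?_
      rw [Finset.sum_div]
      refine Finset.sum_congr rfl fun s _ => ?_
      field_simp
    have h2 : fanoSlack ε / (n * Real.log 2) ≤ fanoSlack ε / Real.log 2 :=
      div_le_div_of_nonneg_left (fanoSlack_nonneg hε0 hε1) hlog
        (le_mul_of_one_le_left hlog.le hn1)
    have h3 : (1 - ε) * T ≤ (1 - ε) * LM / (n * Real.log 2) := by
      rw [le_div_iff₀ (by positivity)]
      calc (1 - ε) * T * (n * Real.log 2) = (1 - ε) * (T * n * Real.log 2) := by ring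
        _ ≤ (1 - ε) * LM := mul_le_mul_of_nonneg_left hT (by linarith)
    have h4 := div_le_div_of_nonneg_right hLM (mul_pos hn0 hlog).le
    rw [add_div] at h4
    rw [h1]
    linarith
  refine ⟨fun i => 1 / (n : ℝ) * ∏ j, C.stateLaw (i.2 j), ⟨fun i => mul_nonneg (by positivity)
    (Finset.prod_nonneg fun j _ => C.stateLaw_mem.1 _), ?_⟩,
    fun i => C.inducedPolicy c hMa hMb i.1 i.2, ?_, ?_, ?_⟩
  · rw [Fintype.sum_prod_type]
    simp only [← Finset.mul_sum, hP1, mul_one, Finset.sum_const, Finset.card_univ,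
      Fintype.card_fin, nsmul_eq_mul]
    field_simp
  · refine hdiv _ _ _ hla ?_
    refine (C.fano_blockCode c hMa hMb Prod.snd (fun l s t => outGiven
      (uniformPush fun w => C.inputA c w s t) (C.chan (s t)) (C.inputB c l s t))
      (fun l s t => outGiven_mem (hA s t) (C.chan_mem _) _)
      (fun w s t y hne => outGiven_ne_zero (hA s t).1 (C.chan_mem _)
        (uniformPush_apply_ne_zero _ w.1) hne) hMa1 (by simp) hε0 hε1 herr).trans
      (add_le_add_left (le_of_eq ?_) _)
    refine Finset.sum_congr rfl fun t _ => ?_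
    simp only [infoA_mul_log_two]
    rw [← C.sum_states_eq_sum_inducedPolicy c hMa hMb t
      fun a p r => divFirst p r (C.chan a)]
    refine Finset.sum_congr rfl fun s _ => ?_
    rw [divFirst, meanLogRatio_uniformPush]
  · refine hdiv _ _ _ hlb ?_
    refine (C.fano_blockCode c hMa hMb Prod.fst (fun l s t => outGiven
      (uniformPush fun w => C.inputB c w s t) (fun b a => C.chan (s t) a b) (C.inputA c l s t))
      (fun l s t => outGiven_mem (hB s t) (fun b a => C.chan_mem _ a b) _)
      (fun w s t y hne => outGiven_ne_zero (K := fun b a => C.chan (s t) a b) (hB s t).1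
        (fun b a => C.chan_mem _ a b) (uniformPush_apply_ne_zero _ w.2) hne)
      hMb1 (by simp [mul_comm]) hε0 hε1 herr).trans (add_le_add_left (le_of_eq ?_) _)
    refine Finset.sum_congr rfl fun t _ => ?_
    simp only [infoB_mul_log_two]
    rw [← C.sum_states_eq_sum_inducedPolicy c hMa hMb t
      fun a p r => divSecond p r (C.chan a)]
    refine Finset.sum_congr rfl fun s _ => ?_
    rw [divSecond, meanLogRatio_uniformPush]
  · refine hdiv _ (Real.log (Ma * Mb)) _ ?_ ?_
    · rw [Real.log_mul hMa'.ne' hMb'.ne']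
      linarith
    refine (C.fano_blockCode c hMa hMb (fun _ => ()) (fun _ s t => outBoth
      (uniformPush fun w => C.inputA c w s t) (uniformPush fun w => C.inputB c w s t)
      (C.chan (s t)))
      (fun l s t => outBoth_mem (hA s t) (hB s t) (C.chan_mem _))
      (fun w s t y hne => outBoth_ne_zero (hA s t) (hB s t).1 (C.chan_mem _)
        (uniformPush_apply_ne_zero _ w.1) (uniformPush_apply_ne_zero _ w.2) hne)
      (one_le_mul_of_one_le_of_one_le hMa1 hMb1) (by simp) hε0 hε1 herr).trans
      (add_le_add_left (le_of_eq ?_) _)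
    refine Finset.sum_congr rfl fun t _ => ?_
    simp only [infoSum_mul_log_two]
    rw [← C.sum_states_eq_sum_inducedPolicy c hMa hMb t
      fun a p r => divBoth p r (C.chan a)]
    refine Finset.sum_congr rfl fun s _ => ?_
    rw [divBoth, meanLogRatio_uniformPush]

end FSMAC

/-! ### Averages of pentagons -/

theorem exists_mul_eq_of_le {a b : ℝ} (ha : 0 ≤ a) (hab : a ≤ b) :
    ∃ α, 0 ≤ α ∧ α ≤ 1 ∧ α * b = a := by
  rcases (ha.trans hab).eq_or_lt with h | h
  · exact ⟨0, le_rfl, zero_le_one, by linarith⟩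
  · exact ⟨a / b, div_nonneg ha h.le, (div_le_one h).2 hab, div_mul_cancel₀ _ h.ne'⟩

/-- A pair satisfying the averaged pentagon inequalities is the average of pairs from the
individual pentagons. -/
theorem exists_pentagon_decomposition {ι : Type*} [Fintype ι] {μ : ι → ℝ}
    (hμ : μ ∈ stdSimplex ℝ ι) {A B T : ι → ℝ} (hA : ∀ i, 0 ≤ A i) (hB : ∀ i, 0 ≤ B i)
    (hAT : ∀ i, A i ≤ T i) (hBT : ∀ i, B i ≤ T i) (hT : ∀ i, T i ≤ A i + B i) {R : ℝ × ℝ}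
    (h1 : 0 ≤ R.1) (h2 : 0 ≤ R.2) (hRA : R.1 ≤ ∑ i, μ i * A i) (hRB : R.2 ≤ ∑ i, μ i * B i)
    (hRT : R.1 + R.2 ≤ ∑ i, μ i * T i) :
    ∃ z : ι → ℝ × ℝ, (∀ i, (0 ≤ (z i).1 ∧ (z i).1 ≤ A i) ∧ (0 ≤ (z i).2 ∧ (z i).2 ≤ B i) ∧
      (0 ≤ (z i).1 + (z i).2 ∧ (z i).1 + (z i).2 ≤ T i)) ∧ ∑ i, μ i • z i = R := by
  set a := ∑ i, μ i * A i with ha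
  set b := ∑ i, μ i * B i with hb
  set τ := ∑ i, μ i * T i with hτ
  have hτab : τ ≤ a + b := by
    rw [ha, hb, hτ, ← Finset.sum_add_distrib]
    refine Finset.sum_le_sum fun i _ => ?_
    rw [← mul_add]
    exact mul_le_mul_of_nonneg_left (hT i) (hμ.1 i)
  have hbτ : b ≤ τ := Finset.sum_le_sum fun i _ => mul_le_mul_of_nonneg_left (hBT i) (hμ.1 i)
  -- The point with first coordinate `x` on the dominant face of the averaged pentagon, at the
  -- position `θ` between its two corners, dominates `R`.
  set x := max R.1 (τ - b) with hx
  have hxa : x ≤ a := max_le hRA (by linarith)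
  obtain ⟨θ, hθ0, hθ1, hθ⟩ := exists_mul_eq_of_le (a := x - (τ - b)) (b := a - (τ - b))
    (sub_nonneg.2 (le_max_right _ _)) (by linarith)
  have hxR : R.1 ≤ x := le_max_left _ _
  have hxR2 : R.2 ≤ τ - x := by
    have : x ≤ τ - R.2 := max_le (by linarith) (by linarith)
    linarith
  obtain ⟨α, hα0, hα1, hα⟩ := exists_mul_eq_of_le h1 hxR
  obtain ⟨β, hβ0, hβ1, hβ⟩ := exists_mul_eq_of_le h2 hxR2
  set u : ι → ℝ := fun i => θ * A i + (1 - θ) * (T i - B i) with hu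
  set v : ι → ℝ := fun i => θ * (T i - A i) + (1 - θ) * B i with hv
  have hθ' : 0 ≤ 1 - θ := by linarith
  have hu0 : ∀ i, 0 ≤ u i := fun i =>
    add_nonneg (mul_nonneg hθ0 (hA i)) (mul_nonneg hθ' (sub_nonneg.2 (hBT i)))
  have hv0 : ∀ i, 0 ≤ v i := fun i =>
    add_nonneg (mul_nonneg hθ0 (sub_nonneg.2 (hAT i))) (mul_nonneg hθ' (hB i))
  have huA : ∀ i, u i ≤ A i := fun i => by
    have := mul_le_mul_of_nonneg_left (sub_le_iff_le_add.2 (hT i)) hθ'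
    simp only [hu]
    linarith
  have hvB : ∀ i, v i ≤ B i := fun i => by
    have := mul_le_mul_of_nonneg_left (sub_le_iff_le_add'.2 (hT i)) hθ0
    simp only [hv]
    linarith
  have huv : ∀ i, u i + v i = T i := fun i => by
    simp only [hu, hv]
    ring
  have hsu : ∑ i, μ i * u i = x := by
    have : ∑ i, μ i * u i = θ * a + (1 - θ) * (τ - b) := by
      rw [ha, hb, hτ, ← Finset.sum_sub_distrib, Finset.mul_sum, Finset.mul_sum,
        ← Finset.sum_add_distrib]
      refine Finset.sum_congr rfl fun i _ => ?_
      simp only [hu]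
      ring
    rw [this]
    linarith
  have hsv : ∑ i, μ i * v i = τ - x := by
    rw [← hsu, hτ, ← Finset.sum_sub_distrib]
    refine Finset.sum_congr rfl fun i _ => ?_
    rw [← huv i]
    ring
  refine ⟨fun i => (α * u i, β * v i), fun i => ?_, ?_⟩
  · have e1 : 0 ≤ α * u i := mul_nonneg hα0 (hu0 i)
    have e2 : 0 ≤ β * v i := mul_nonneg hβ0 (hv0 i)
    have e3 : α * u i ≤ u i := mul_le_of_le_one_left (hu0 i) hα1
    have e4 : β * v i ≤ v i := mul_le_of_le_one_left (hv0 i) hβ1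
    refine ⟨⟨e1, e3.trans (huA i)⟩, ⟨e2, e4.trans (hvB i)⟩, add_nonneg e1 e2, ?_⟩
    have := huv i
    dsimp only
    linarith
  · refine Prod.ext ?_ ?_
    · rw [Prod.fst_sum, ← hα, ← hsu, Finset.mul_sum]
      refine Finset.sum_congr rfl fun i _ => ?_
      simp only [Prod.smul_mk, smul_eq_mul]
      ring
    · rw [Prod.snd_sum, ← hβ, ← hsv, Finset.mul_sum]
      refine Finset.sum_congr rfl fun i _ => ?_
      simp only [Prod.smul_mk, smul_eq_mul]
      ring

/-! ### The capacity region -/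

namespace TeamPolicy

variable {Va Vb Xa Xb : Type*} [Fintype Xa] [Fintype Xb]

/-- The team policy whose input laws are the mixtures, with weights `1 - δ` and `δ`, of those of
`π` and `π'`. -/
def mix (δ : ℝ) (h0 : 0 ≤ δ) (h1 : δ ≤ 1) (π π' : TeamPolicy Va Vb Xa Xb) :
    TeamPolicy Va Vb Xa Xb where
  πa v := (1 - δ) • π.πa v + δ • π'.πa v
  πa_mem v := convex_stdSimplex ℝ Xa (π.πa_mem v) (π'.πa_mem v) (sub_nonneg.2 h1) h0 (by ring)
  πb v := (1 - δ) • π.πb v + δ • π'.πb v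
  πb_mem v := convex_stdSimplex ℝ Xb (π.πb_mem v) (π'.πb_mem v) (sub_nonneg.2 h1) h0 (by ring)

end TeamPolicy

namespace FSMAC

variable {S Va Vb Xa Xb Y : Type*} [Fintype S] [Fintype Xa] [Fintype Xb] [Fintype Y]
  (C : FSMAC S Va Vb Xa Xb Y)

section Monotone

variable {π π' : TeamPolicy Va Vb Xa Xb} {δ : ℝ}

theorem mul_infoA_le_of_le (hδ : 0 < δ) (ha : ∀ v x, δ * π.πa v x ≤ π'.πa v x)
    (hb : ∀ v x, δ * π.πb v x ≤ π'.πb v x) : δ * δ * C.infoA π ≤ C.infoA π' := by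
  refine le_of_mul_le_mul_right ?_ (Real.log_pos one_lt_two)
  rw [mul_assoc, infoA_mul_log_two, infoA_mul_log_two, Finset.mul_sum]
  refine Finset.sum_le_sum fun s _ => ?_
  have := mul_divFirst_le_of_le (π.πa_mem (C.qa s)) (π.πb_mem (C.qb s)) (π'.πa_mem (C.qa s))
    (C.chan_mem s) hδ (ha _) (hb (C.qb s))
  rw [mul_left_comm]
  exact mul_le_mul_of_nonneg_left this (C.stateLaw_mem.1 s)

theorem mul_infoB_le_of_le (hδ : 0 < δ) (ha : ∀ v x, δ * π.πa v x ≤ π'.πa v x)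
    (hb : ∀ v x, δ * π.πb v x ≤ π'.πb v x) : δ * δ * C.infoB π ≤ C.infoB π' := by
  refine le_of_mul_le_mul_right ?_ (Real.log_pos one_lt_two)
  rw [mul_assoc, infoB_mul_log_two, infoB_mul_log_two, Finset.mul_sum]
  refine Finset.sum_le_sum fun s _ => ?_
  have := mul_divSecond_le_of_le (π.πa_mem (C.qa s)) (π.πb_mem (C.qb s)) (π'.πb_mem (C.qb s))
    (C.chan_mem s) hδ (ha (C.qa s)) (hb _)
  rw [mul_left_comm]
  exact mul_le_mul_of_nonneg_left this (C.stateLaw_mem.1 s)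

end Monotone

theorem capacityRegion_subset : C.capacityRegion ⊆
    closure (convexHull ℝ (⋃ π : TeamPolicy Va Vb Xa Xb, C.closedRegion π)) := by
  refine closure_minimal (fun R hR => ?_) isClosed_closure
  obtain ⟨h1, h2, hach⟩ := hR
  set g : ℝ → ℝ := fun ε => fanoSlack ε / Real.log 2 with hg
  have hlim : Tendsto (fun ε : ℝ => (max 0 ((1 - ε) * R.1 - g ε), max 0 ((1 - ε) * R.2 - g ε)))
      (𝓝[>] 0) (𝓝 R) := by
    have hgl : Tendsto g (𝓝[>] 0) (𝓝 0) := by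
      simpa using tendsto_fanoSlack.div_const (Real.log 2)
    have hε : Tendsto (fun ε : ℝ => 1 - ε) (𝓝[>] 0) (𝓝 1) := by
      have : Tendsto (fun ε : ℝ => 1 - ε) (𝓝 0) (𝓝 (1 - 0)) := by
        exact (continuous_const.sub continuous_id).tendsto 0
      rw [sub_zero] at this
      exact this.mono_left nhdsWithin_le_nhds
    have hc : ∀ r : ℝ, 0 ≤ r →
        Tendsto (fun ε : ℝ => max 0 ((1 - ε) * r - g ε)) (𝓝[>] 0) (𝓝 r) := fun r hr => by
      have := (tendsto_const_nhds (x := (0 : ℝ))).max ((hε.mul_const r).sub hgl)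
      simpa [hr] using this
    exact (hc _ h1).prodMk_nhds (hc _ h2)
  refine mem_closure_of_tendsto hlim ?_
  filter_upwards [Ioo_mem_nhdsGT (zero_lt_one (α := ℝ))] with ε hε
  obtain ⟨n, hn, hcode⟩ := hach ε hε.1
  obtain ⟨μ, hμ, π, hA, hB, hT⟩ := C.exists_mixture_of_hasCodingScheme hn hε.1 hε.2 hcode
  have hg0 : 0 ≤ g ε := div_nonneg (fanoSlack_nonneg hε.1 hε.2) (Real.log_pos one_lt_two).le
  have hA0 : 0 ≤ ∑ i, μ i * C.infoA (π i) :=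
    Finset.sum_nonneg fun i _ => mul_nonneg (hμ.1 i) (C.infoA_nonneg _)
  have hB0 : 0 ≤ ∑ i, μ i * C.infoB (π i) :=
    Finset.sum_nonneg fun i _ => mul_nonneg (hμ.1 i) (C.infoB_nonneg _)
  have hAT : ∑ i, μ i * C.infoA (π i) ≤ ∑ i, μ i * C.infoSum (π i) :=
    Finset.sum_le_sum fun i _ => mul_le_mul_of_nonneg_left (C.infoA_le_infoSum _) (hμ.1 i)
  have hBT : ∑ i, μ i * C.infoB (π i) ≤ ∑ i, μ i * C.infoSum (π i) :=
    Finset.sum_le_sum fun i _ => mul_le_mul_of_nonneg_left (C.infoB_le_infoSum _) (hμ.1 i)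
  obtain ⟨z, hz, hzR⟩ := exists_pentagon_decomposition hμ (fun i => C.infoA_nonneg (π i))
    (fun i => C.infoB_nonneg (π i)) (fun i => C.infoA_le_infoSum (π i))
    (fun i => C.infoB_le_infoSum (π i)) (fun i => C.infoSum_le_infoA_add_infoB (π i))
    (R := (max 0 ((1 - ε) * R.1 - g ε), max 0 ((1 - ε) * R.2 - g ε)))
    (le_max_left _ _) (le_max_left _ _) (max_le hA0 (by linarith)) (max_le hB0 (by linarith))
    (by
      dsimp only
      rcases max_cases 0 ((1 - ε) * R.1 - g ε) with ⟨e1, _⟩ | ⟨e1, _⟩ <;>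
      rcases max_cases 0 ((1 - ε) * R.2 - g ε) with ⟨e2, _⟩ | ⟨e2, _⟩ <;>
      rw [e1, e2] <;> linarith)
  rw [← hzR]
  exact (convex_convexHull ℝ _).sum_mem (fun i _ => hμ.1 i) hμ.2
    fun i _ => subset_convexHull ℝ _ (Set.mem_iUnion.2 ⟨π i, hz i⟩)

theorem subset_capacityRegion :
    closure (convexHull ℝ (⋃ π : TeamPolicy Va Vb Xa Xb, C.closedRegion π)) ⊆
      C.capacityRegion := by
  refine closure_minimal (fun R hR => ?_) isClosed_closure
  obtain ⟨ι, _, w, z, hw0, hw1, hz, rfl⟩ := mem_convexHull_iff_exists_fintype.1 hR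
  choose π hπ using fun i => Set.mem_iUnion.1 (hz i)
  set R := ∑ i, w i • z i with hRdef
  have e1 : R.1 = ∑ i, w i * (z i).1 := by
    simp [hRdef, Prod.fst_sum]
  have e2 : R.2 = ∑ i, w i * (z i).2 := by
    simp [hRdef, Prod.snd_sum]
  have h1 : 0 ≤ R.1 := by
    rw [e1]
    exact Finset.sum_nonneg fun i _ => mul_nonneg (hw0 i) (hπ i).1.1
  have h2 : 0 ≤ R.2 := by
    rw [e2]
    exact Finset.sum_nonneg fun i _ => mul_nonneg (hw0 i) (hπ i).2.1.1
  have hA : R.1 ≤ ∑ i, w i * C.infoA (π i) := by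
    rw [e1]
    exact Finset.sum_le_sum fun i _ => mul_le_mul_of_nonneg_left (hπ i).1.2 (hw0 i)
  have hB : R.2 ≤ ∑ i, w i * C.infoB (π i) := by
    rw [e2]
    exact Finset.sum_le_sum fun i _ => mul_le_mul_of_nonneg_left (hπ i).2.1.2 (hw0 i)
  have hT : R.1 + R.2 ≤ ∑ i, w i * C.infoSum (π i) := by
    rw [e1, e2, ← Finset.sum_add_distrib]
    refine Finset.sum_le_sum fun i _ => ?_
    rw [← mul_add]
    exact mul_le_mul_of_nonneg_left (hπ i).2.2.2 (hw0 i)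
  have hlim : Tendsto (fun δ : ℝ => (1 - δ) • R) (𝓝[>] 0) (𝓝 R) := by
    have : Tendsto (fun δ : ℝ => (1 - δ) • R) (𝓝 0) (𝓝 ((1 - (0 : ℝ)) • R)) :=
      ((continuous_const.sub continuous_id).smul continuous_const).tendsto 0
    rw [sub_zero, one_smul] at this
    exact this.mono_left nhdsWithin_le_nhds
  refine mem_closure_of_tendsto hlim ?_
  filter_upwards [Ioo_mem_nhdsGT (zero_lt_one (α := ℝ))] with δ hδ
  have hδ' : 0 ≤ 1 - δ := by linarith [hδ.2]
  -- Scaling down turns a weak inequality for a positive rate into a strict one.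
  have hlt : ∀ r I : ℝ, 0 ≤ r → r ≤ I → r = 0 ∨ (1 - δ) * r < I := fun r I hr hrI => by
    rcases hr.eq_or_lt with h | h
    · exact Or.inl h.symm
    · exact Or.inr (by nlinarith [mul_pos hδ.1 h])
  refine C.achievable_of_lt_mixture ⟨hw0, hw1⟩ π (mul_nonneg hδ' h1) (mul_nonneg hδ' h2) ?_ ?_ ?_
  · exact (hlt _ _ h1 hA).imp_left fun h => by simp [h]
  · exact (hlt _ _ h2 hB).imp_left fun h => by simp [h]
  · rcases hlt _ _ (add_nonneg h1 h2) hT with h | h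
    · left
      have : R.1 = 0 := by linarith
      simp [this]
    · right; right
      simpa [mul_add] using h

theorem region_subset_closedRegion (π : TeamPolicy Va Vb Xa Xb) :
    C.region π ⊆ C.closedRegion π :=
  fun _ h => ⟨⟨h.1.1, h.1.2.le⟩, ⟨h.2.1.1, h.2.1.2.le⟩, h.2.2.1, h.2.2.2.le⟩

/-- As soon as some strict region is nonempty, the strict regions approximate the closed ones. A
policy for which one of the informations vanishes is perturbed towards one for which both are
positive. -/
theorem closedRegion_subset_closure {π₀ : TeamPolicy Va Vb Xa Xb} (h₀ : (C.region π₀).Nonempty)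
    (π : TeamPolicy Va Vb Xa Xb) :
    C.closedRegion π ⊆ closure (⋃ π : TeamPolicy Va Vb Xa Xb, C.region π) := by
  rintro R ⟨⟨h1, hA⟩, ⟨h2, hB⟩, -, hT⟩
  obtain ⟨R₀, ⟨h01, hA0⟩, ⟨h02, hB0⟩, -⟩ := h₀
  replace hA0 := h01.trans_lt hA0
  replace hB0 := h02.trans_lt hB0
  have hlim : Tendsto (fun δ : ℝ => (1 - δ) ^ 3 • R) (𝓝[>] 0) (𝓝 R) := by
    have : Tendsto (fun δ : ℝ => (1 - δ) ^ 3 • R) (𝓝 0) (𝓝 ((1 - (0 : ℝ)) ^ 3 • R)) :=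
      (((continuous_const.sub continuous_id).pow 3).smul continuous_const).tendsto 0
    rw [sub_zero, one_pow, one_smul] at this
    exact this.mono_left nhdsWithin_le_nhds
  refine mem_closure_of_tendsto hlim ?_
  filter_upwards [Ioo_mem_nhdsGT (zero_lt_one (α := ℝ))] with δ hδ
  have hδ' : 0 < 1 - δ := by linarith [hδ.2]
  have n1 : 0 ≤ (1 - δ) ^ 3 * R.1 := mul_nonneg (by positivity) h1
  have n2 : 0 ≤ (1 - δ) ^ 3 * R.2 := mul_nonneg (by positivity) h2
  have hc2 : (1 - δ) ^ 2 ≤ 1 := pow_le_one₀ hδ'.le (by linarith [hδ.1])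
  have hcube : ∀ r : ℝ, 0 < r → (1 - δ) ^ 3 * r < (1 - δ) * (1 - δ) * r := fun r hr => by
    have : (1 - δ) ^ 3 * r = (1 - δ) * (1 - δ) * r - δ * ((1 - δ) * (1 - δ) * r) := by ring
    have := mul_pos hδ.1 (mul_pos (mul_pos hδ' hδ') hr)
    linarith
  by_cases hpos : 0 < R.1 ∧ 0 < R.2
  · have hs : ∀ r I : ℝ, 0 < r → r ≤ I → (1 - δ) ^ 3 * r < I := fun r I hr hrI => by
      have := hcube r hr
      nlinarith
    refine Set.mem_iUnion.2 ⟨π, ⟨n1, hs _ _ hpos.1 hA⟩, ⟨n2, hs _ _ hpos.2 hB⟩,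
      add_nonneg n1 n2, ?_⟩
    have := hs _ _ (add_pos hpos.1 hpos.2) hT
    rwa [mul_add] at this
  · set π' := TeamPolicy.mix δ hδ.1.le hδ.2.le π π₀ with hπ'
    have ma : ∀ v x, (1 - δ) * π.πa v x ≤ π'.πa v x := fun v x =>
      le_add_of_nonneg_right (mul_nonneg hδ.1.le ((π₀.πa_mem v).1 x))
    have mb : ∀ v x, (1 - δ) * π.πb v x ≤ π'.πb v x := fun v x =>
      le_add_of_nonneg_right (mul_nonneg hδ.1.le ((π₀.πb_mem v).1 x))
    have ma' : ∀ v x, δ * π₀.πa v x ≤ π'.πa v x := fun v x =>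
      le_add_of_nonneg_left (mul_nonneg hδ'.le ((π.πa_mem v).1 x))
    have mb' : ∀ v x, δ * π₀.πb v x ≤ π'.πb v x := fun v x =>
      le_add_of_nonneg_left (mul_nonneg hδ'.le ((π.πb_mem v).1 x))
    have hs : ∀ r I I₀ I' : ℝ, 0 ≤ r → r ≤ I → 0 < I₀ → (1 - δ) * (1 - δ) * I ≤ I' →
        δ * δ * I₀ ≤ I' → (1 - δ) ^ 3 * r < I' := fun r I I₀ I' hr hrI hI₀ hI hI' => by
      rcases hr.eq_or_lt with h | h
      · rw [← h, mul_zero]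
        exact (mul_pos (mul_pos hδ.1 hδ.1) hI₀).trans_le hI'
      · exact (hcube r h).trans_le
          ((mul_le_mul_of_nonneg_left hrI (mul_pos hδ' hδ').le).trans hI)
    have k1 : (1 - δ) ^ 3 * R.1 < C.infoA π' := hs _ _ _ _ h1 hA hA0
      (C.mul_infoA_le_of_le hδ' ma mb) (C.mul_infoA_le_of_le hδ.1 ma' mb')
    have k2 : (1 - δ) ^ 3 * R.2 < C.infoB π' := hs _ _ _ _ h2 hB hB0
      (C.mul_infoB_le_of_le hδ' ma mb) (C.mul_infoB_le_of_le hδ.1 ma' mb')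
    refine Set.mem_iUnion.2 ⟨π', ⟨n1, k1⟩, ⟨n2, k2⟩, add_nonneg n1 n2, ?_⟩
    change (1 - δ) ^ 3 * R.1 + (1 - δ) ^ 3 * R.2 < C.infoSum π'
    have hAT := C.infoA_le_infoSum π'
    have hBT := C.infoB_le_infoSum π'
    rcases h1.eq_or_lt with h | h
    · rw [← h, mul_zero]
      linarith
    · have : R.2 = 0 := le_antisymm (not_lt.1 fun h' => hpos ⟨h, h'⟩) h2
      rw [this, mul_zero]
      linarith

end FSMAC

theorem theorem1 {S Va Vb Xa Xb Y : Type*} [Fintype S] [Fintype Xa] [Fintype Xb] [Fintype Y]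
    (C : FSMAC S Va Vb Xa Xb Y) :
    ((∃ π : TeamPolicy Va Vb Xa Xb, (C.region π).Nonempty) →
      C.capacityRegion =
        closure (convexHull ℝ (⋃ π : TeamPolicy Va Vb Xa Xb, C.region π))) ∧
    C.capacityRegion =
      closure (convexHull ℝ (⋃ π : TeamPolicy Va Vb Xa Xb, C.closedRegion π)) := by
  have hcap : C.capacityRegion =
      closure (convexHull ℝ (⋃ π : TeamPolicy Va Vb Xa Xb, C.closedRegion π)) :=
    C.capacityRegion_subset.antisymm C.subset_capacityRegion
  refine ⟨fun ⟨π₀, h₀⟩ => ?_, hcap⟩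
  rw [hcap]
  refine (closure_minimal (convexHull_min (Set.iUnion_subset fun π => ?_)
    (convex_convexHull ℝ _).closure) isClosed_closure).antisymm
    (closure_mono (convexHull_mono (Set.iUnion_mono C.region_subset_closedRegion)))
  exact (C.closedRegion_subset_closure h₀ π).trans (closure_mono (subset_convexHull ℝ _))
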